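/- **Setting.** A *finite subdivision rule* $R$ of dimension $d$ consists of a finite CW complex $S$ that is the union of its closed $d$-cells, a finite CW complex $R(S)$ that is a subdivision of $S$, and a continuous cellular map $\varphi:R(S)\to S$ that maps every open cell homeomorphically onto an open cell. For every $d$-cell of $S$ it is required that the closed $d$-disk has a CW structure whose only $d$-cell is the open disk, in which any two distinct closed cells that intersect do so in a single closed cell of lower dimension, and all of whose open cells are mapped homeomorphically onto open cells of $S$ by the characteristic map. Some of the $d$-cells of $S$ (the *tile types*) may be designated as *ideal*, provided that ideal tile types subdivide only into ideal ones. An *$R$-complex* is a CW complex $X$ that is the union of its closed $d$-cells, with a continuous cellular map $f:X\to S$ that maps every open cell homeomorphically onto an open cell. Put $R^0(X)=X$; the complex $R^{n+1}(X)$ is the subdivision of $R^n(X)$ obtained by pulling back the cell structure of $R(S)$ along the map $\varphi^n\circ f:R^n(X)\to S$ on each cell. Let $\Gamma_n$ be the dual graph of $R^n(X)$: its vertices are the non-ideal $d$-cells of $R^n(X)$, two of them being adjacent if they share a $(d-1)$-cell; let $diam_X(n)\in\mathbb N\cup\{\infty\}$ be the diameter of $\Gamma_n$ in its path metric $d_{R^n(X)}$.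 The *history graph* $\Gamma$ is the disjoint union of $\Gamma_0,\Gamma_1,\Gamma_2,\dots$ together with an edge from each vertex of $\Gamma_n$ to each vertex of $\Gamma_{n+1}$ whose cell is contained in its cell. The rule $R$ acting on $X$ is *associated to* a group $G$ with finite generating set $T$ if $\Gamma$ is quasi-isometric to the Cayley graph of $(G,T)$. The *divergence* $div_G(n)\in\mathbb N\cup\{\infty\}$ is the supremum, over all bi-infinite geodesics $\gamma:\mathbb Z\to G$ in the Cayley graph of $(G,T)$, of the length of a shortest path from $\gamma(-n)$ to $\gamma(n)$ in the complement of the open ball of radius $n$ about $\gamma(0)$ ($\infty$ if there is no such path). For $g,h:\mathbb N\to\mathbb N\cup\{\infty\}$ write $g\preceq h$ if there are $a,b\in\mathbb N$ with $g(n)\le a\,h(an+b)+an+b$ for all $n$. **Theorem.** Let $R$ be a finite subdivision rule acting on a finite $R$-complex $X$ and associated to a group $G$ with finite generating set $T$. Then $div_G(n)\preceq diam_X(n)$. Conversely, if there are geodesic rays $\alpha,\beta$ in the history graph with $\alpha(n),\beta(n)\in\Gamma_n$ and $d_{R^n(X)}(\alpha(n),\beta(n))=diam_X(n)$ for all $n\ge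 0$ (for instance the two halves of a bi-infinite geodesic $\gamma$ with $\gamma(n),\gamma(-n)\in\Gamma_n$ and $d_{R^n(X)}(\gamma(n),\gamma(-n))=diam_X(n)$), then $diam_X(n)\preceq div_G(n)$. -/

import Mathlib

open Set Metric Topology

universe u v

/-! ## Cells of CW complexes, seen as sets -/

/-- The open `k`-cells of a CW complex, as subsets of the ambient space.  In a Hausdorff space the
closed cell belonging to an open cell `e` is `closure e`. -/
def openCells {Y : Type u} [TopologicalSpace Y] {C : Set Y} (K : CWComplex C) (k : ℕ) :
    Set (Set Y) :=
  Set.range fun i : K.cell k => K.map k i '' ball 0 1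

/-- The complex has finitely many cells. -/
def IsFiniteComplex {Y : Type u} [TopologicalSpace Y] {C : Set Y} (K : CWComplex C) : Prop :=
  (⋃ k, openCells K k).Finite

/-- `Y` is the union of the closed `d`-cells of `K` (so `K` is pure of dimension `d`, unless `Y` is
empty). -/
def IsPure {Y : Type u} [TopologicalSpace Y] (K : CWComplex (univ : Set Y)) (d : ℕ) : Prop :=
  ⋃ e ∈ openCells K d, closure e = (univ : Set Y)

/-- `f` restricts to a homeomorphism from `e` onto `c`. -/
def RestrictsToHomeo {Y : Type u} {Z : Type v} [TopologicalSpace Y] [TopologicalSpace Z]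
    (f : Y → Z) (e : Set Y) (c : Set Z) : Prop :=
  f '' e = c ∧ IsEmbedding (e.domRestrict f)

/-- `f` maps every open cell of `K` homeomorphically onto an open cell of `L` (of the same
dimension, so that `f` is cellular). -/
def IsCellwiseHomeo {Y : Type u} {Z : Type v} [TopologicalSpace Y] [TopologicalSpace Z]
    {C : Set Y} {D : Set Z} (K : CWComplex C) (L : CWComplex D) (f : Y → Z) : Prop :=
  ∀ k, ∀ e ∈ openCells K k, ∃ c ∈ openCells L k, RestrictsToHomeo f e c

/-- `K'` is a subdivision of `K`: every open cell of `K'` lies in an open cell of `K` (of at least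
its dimension).  As the open cells of `K'` partition the space, every cell of `K` is then a union
of cells of `K'`. -/
def IsSubdivision {Y : Type u} [TopologicalSpace Y] (K' K : CWComplex (univ : Set Y)) : Prop :=
  ∀ k, ∀ c ∈ openCells K' k, ∃ m ≥ k, ∃ e ∈ openCells K m, c ⊆ e

/-- A map `ψ` from the closed `d`-disk (realised as the closed unit ball of `Fin d → ℝ` with the
sup norm, which is the domain of the characteristic maps in Mathlib) to the complex `K` makes the
disk a *tile type*: there is a CW structure on the disk, with the open ball as its only `d`-cell
and all other cells in the boundary, in which any two distinct closed cells that intersect do so in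
a single closed cell of lower dimension, and such that `ψ` maps every open cell homeomorphically
onto an open cell of `K`. -/
def IsTileType {Y : Type u} [TopologicalSpace Y] (K : CWComplex (univ : Set Y)) {d : ℕ}
    (ψ : (Fin d → ℝ) → Y) : Prop :=
  ∃ P : CWComplex (closedBall (0 : Fin d → ℝ) 1),
    openCells P d = {ball 0 1} ∧
    (∀ k, ∀ c ∈ openCells P k, c ≠ ball 0 1 → c ⊆ sphere 0 1) ∧
    (∀ k l, ∀ c ∈ openCells P k, ∀ c' ∈ openCells P l, c ≠ c' →
      (closure c ∩ closure c').Nonempty →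
      ∃ m < max k l, ∃ b ∈ openCells P m, closure c ∩ closure c' = closure b) ∧
    IsCellwiseHomeo P K ψ

/-! ## Subdivision rules -/

/-- A finite subdivision rule of dimension `d` with subdivision complex `S`, together with the
choice of those tile types that are ideal. -/
structure SubdivisionRule (S : Type u) [TopologicalSpace S] [T2Space S] (d : ℕ) where
  /-- the cell structure of the subdivision complex -/
  cw : CWComplex (univ : Set S)
  finite_cw : IsFiniteComplex cw
  pure_cw : IsPure cw d
  /-- every characteristic map of a `d`-cell is a tile type -/
  isTileType : ∀ i : cw.cell d, IsTileType cw (cw.map d i)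
  /-- the subdivided complex `R(S)` -/
  sub : CWComplex (univ : Set S)
  finite_sub : IsFiniteComplex sub
  isSubdivision : IsSubdivision sub cw
  /-- the subdivision map `R(S) → S` -/
  φ : S → S
  continuous_φ : Continuous φ
  cellwise_φ : IsCellwiseHomeo sub cw φ
  /-- the ideal tile types, as open `d`-cells of `S` -/
  ideal : Set (Set S)
  ideal_subset : ideal ⊆ openCells cw d
  /-- ideal tiles only subdivide into ideal tiles -/
  ideal_subdivides : ∀ e ∈ ideal, ∀ c ∈ openCells sub d, c ⊆ e → φ '' c ∈ ideal

/-- An `R`-complex: a CW structure on `X`, the union of its closed `d`-cells, with a continuous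
cellular map to `S` that is a homeomorphism on every open cell. -/
structure RComplex {S : Type u} [TopologicalSpace S] [T2Space S] {d : ℕ} (R : SubdivisionRule S d)
    (X : Type v) [TopologicalSpace X] [T2Space X] where
  cw : CWComplex (univ : Set X)
  pure_cw : IsPure cw d
  /-- the structure map `X → S` -/
  f : X → S
  continuous_f : Continuous f
  cellwise_f : IsCellwiseHomeo cw R.cw f

namespace RComplex

variable {S : Type u} [TopologicalSpace S] [T2Space S] {d : ℕ} {R : SubdivisionRule S d}
  {X : Type v} [TopologicalSpace X] [T2Space X] (A : RComplex R X)

/-- The structure map `φⁿ ∘ f` of the `R`-complex `Rⁿ(X)`. -/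
def stageMap (n : ℕ) : X → S := R.φ^[n] ∘ A.f

/-- `A.cells n k` is the set of open `k`-cells of `Rⁿ(X)`.  The cells of `Rⁿ⁺¹(X) = R(Rⁿ(X))` are
obtained by pulling back the cell structure of `R(S)` to the cells of `Rⁿ(X)`. -/
def cells : ℕ → ℕ → Set (Set X)
  | 0, k => openCells A.cw k
  | n + 1, k => {t | ∃ m, ∃ e ∈ cells n m, ∃ c ∈ openCells R.sub k,
      c ⊆ A.stageMap n '' e ∧ t = e ∩ A.stageMap n ⁻¹' c}

/-- The non-ideal tiles of `Rⁿ(X)`: the open `d`-cells whose tile type is not ideal. -/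
def Tile (n : ℕ) : Type v :=
  {t : Set X // t ∈ A.cells n d ∧ A.stageMap n '' t ∉ R.ideal}

/-- Two distinct tiles of `Rⁿ(X)` are adjacent when they have a `(d-1)`-cell in common.  (The
closed tiles are unions of open cells, so a cell that meets a closed tile lies in it.) -/
def FacetAdj (n : ℕ) (s t : Set X) : Prop :=
  s ≠ t ∧ ∃ k, k + 1 = d ∧ ∃ e ∈ A.cells n k, (e ∩ (closure s ∩ closure t)).Nonempty

theorem FacetAdj.symm {A : RComplex R X} {n : ℕ} {s t : Set X} (h : A.FacetAdj n s t) :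
    A.FacetAdj n t s := by
  obtain ⟨hne, k, hk, e, he, hm⟩ := h
  exact ⟨hne.symm, k, hk, e, he, by rwa [Set.inter_comm (closure t)]⟩

/-- The dual graph of `Rⁿ(X)`, with one vertex for every non-ideal tile. -/
def dualGraph (n : ℕ) : SimpleGraph (A.Tile n) where
  Adj s t := A.FacetAdj n s.1 t.1
  symm := ⟨fun _ _ h => h.symm⟩
  loopless := ⟨fun _ h => h.1 rfl⟩

/-- The history graph: the disjoint union of the dual graphs of `Rⁿ(X)`, `n = 0, 1, 2, …`, together
with an edge from each tile of `Rⁿ(X)` to every tile of its subdivision in `Rⁿ⁺¹(X)`. -/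
def historyGraph : SimpleGraph (Σ n, A.Tile n) where
  Adj u v := (u.1 = v.1 ∧ A.FacetAdj u.1 u.2.1 v.2.1) ∨
    (v.1 = u.1 + 1 ∧ v.2.1 ⊆ u.2.1) ∨ (u.1 = v.1 + 1 ∧ u.2.1 ⊆ v.2.1)
  symm := ⟨by
    rintro ⟨n, s⟩ ⟨m, t⟩ (⟨h, h'⟩ | h | h)
    · obtain rfl : n = m := h
      exact Or.inl ⟨rfl, h'.symm⟩
    · exact Or.inr (Or.inr h)
    · exact Or.inr (Or.inl h)⟩
  loopless := ⟨by
    rintro u (⟨_, h⟩ | ⟨h, _⟩ | ⟨h, _⟩)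
    · exact h.1 rfl
    · omega
    · omega⟩

/-- `diam_X(n)`: the diameter of `Rⁿ(X)` in the dual graph metric. -/
noncomputable def diam (n : ℕ) : ℕ∞ := (A.dualGraph n).ediam

end RComplex

/-! ## Coarse geometry of graphs -/

/-- Quasi-isometry of (the vertex sets of) two graphs with their path metrics. -/
def QuasiIsometric {V : Type u} {W : Type v} (H : SimpleGraph V) (K : SimpleGraph W) : Prop :=
  ∃ (f : V → W) (C : ℕ),
    (∀ x y, K.edist (f x) (f y) ≤ C * H.edist x y + C ∧
      H.edist x y ≤ C * K.edist (f x) (f y) + C) ∧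
    ∀ w, ∃ x, K.edist w (f x) ≤ C

/-- Geodesic rays, as sequences of vertices. -/
def IsGeodesicRay {V : Type u} (H : SimpleGraph V) (α : ℕ → V) : Prop :=
  ∀ i j : ℕ, H.edist (α i) (α j) = (((i : ℤ) - j).natAbs : ℕ∞)

/-- Bi-infinite geodesics, as sequences of vertices. -/
def IsGeodesicLine {V : Type u} (H : SimpleGraph V) (γ : ℤ → V) : Prop :=
  ∀ i j : ℤ, H.edist (γ i) (γ j) = ((i - j).natAbs : ℕ∞)

/-- The length of a shortest path from `x` to `y` in the complement of the open ball of radius `n`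
about `o` (`⊤` if there is no such path). -/
noncomputable def avoidantDist {V : Type u} (H : SimpleGraph V) (o : V) (n : ℕ) (x y : V) : ℕ∞ :=
  ⨅ (p : H.Walk x y) (_ : ∀ z ∈ p.support, (n : ℕ∞) ≤ H.edist o z), (p.length : ℕ∞)

/-- The divergence of a graph: the supremum over all bi-infinite geodesics `γ` of the length of a
shortest path from `γ (-n)` to `γ n` avoiding the open ball of radius `n` about `γ 0`. -/
noncomputable def divergence {V : Type u} (H : SimpleGraph V) (n : ℕ) : ℕ∞ :=
  ⨆ (γ : ℤ → V) (_ : IsGeodesicLine H γ), avoidantDist H (γ 0) n (γ (-n)) (γ n)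

/-- The relation `f ≼ g` underlying the equivalence of divergence functions. -/
def Dominated (f g : ℕ → ℕ∞) : Prop :=
  ∃ a b : ℕ, ∀ n : ℕ, f n ≤ a * g (a * n + b) + (a * n + b : ℕ)

/-! Every non-ideal tile has a unique parent tile, and the parents of adjacent tiles coincide or are
adjacent (`isHistory`). So passing to ancestors of a fixed level does not lengthen paths staying
beyond that level. As there are finitely many tiles of level zero, level and distance from a base
tile agree up to a constant.

Upper bound on the divergence. Translate a geodesic line through the image of the base tile. Follow
each half until the corresponding tile reaches a level N linear in n, and join the two tiles inside
level N at a cost of at most the diameter of that level. The detour avoids the ball, and since the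
line is geodesic, the parts of it that are used are bounded linearly by the same diameter
(`avoidantDist_le_of_level`).

Lower bound. Homogeneity of the group moves the base tile close to any deep tile w. Paths avoiding a
ball about w pull back and project to level n (`distLE_ancestor_pullback`). If the rays are far
apart at level n, their images near w therefore cannot both be joined cheaply, around the ball, to a
high ancestor of w. The image for which this fails must descend from the vicinity of w, and so must
a whole horizontal ball around one of its ancestors (`exists_wide_shadow`). Iteration yields a chain
of such shadows (`exists_wideChain`). Passing from outside one shadow into the next without coming
close to the chain vertex costs about the width of the ball (`lt_of_crossing`).

A geodesic along the chain has length linear in the number of shadows, so in its middle third it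
crosses some gap quickly and for good (`exists_crossing`); going around that point is expensive.
Recentred at such points, longer and longer segments converge to a line, which bounds the divergence
below by the width (`WideChain.lt_of_divergence_le`). A large distance between the rays permits a
large width, whence the comparison. -/

section Cells

/-! ### Open cells: disjointness, dimension and openness in top dimension. -/

variable {Y : Type u} [TopologicalSpace Y]

theorem openCells_eq_of_inter_nonempty {C : Set Y} {K : CWComplex C} {k l : ℕ} {c e : Set Y}
    (hc : c ∈ openCells K k) (he : e ∈ openCells K l) (h : (c ∩ e).Nonempty) : k = l ∧ c = e := by
  obtain ⟨i, rfl⟩ := hc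
  obtain ⟨j, rfl⟩ := he
  let _ := K
  have := CWComplex.eq_of_not_disjoint_openCell (C := C) (n := k) (j := i) (m := l) (i := j)
    (by rw [Set.disjoint_iff_inter_eq_empty]; exact h.ne_empty)
  cases this
  exact ⟨rfl, rfl⟩

theorem nonempty_of_mem_openCells {C : Set Y} {K : CWComplex C} {k : ℕ} {c : Set Y}
    (hc : c ∈ openCells K k) : c.Nonempty := by
  obtain ⟨i, rfl⟩ := hc
  exact ⟨_, mem_image_of_mem _ (mem_ball_self one_pos)⟩

theorem IsPure.dim_le [T2Space Y] {K : CWComplex (univ : Set Y)} {d : ℕ} (hK : IsPure K d) {k : ℕ}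
    {c : Set Y} (hc : c ∈ openCells K k) : k ≤ d := by
  let _ := K
  obtain ⟨i, rfl⟩ := hc
  by_contra hk
  have hx := CWComplex.map_zero_mem_openCell (C := (univ : Set Y)) k i
  have hu : RelCWComplex.map (C := (univ : Set Y)) k i 0 ∈ ⋃ e ∈ openCells K d, closure e := by
    rw [hK]; trivial
  simp only [mem_iUnion] at hu
  obtain ⟨e, ⟨j, rfl⟩, he⟩ := hu
  have he' : RelCWComplex.map (C := (univ : Set Y)) k i 0 ∈
      CWComplex.closedCell (C := (univ : Set Y)) d j := by
    rw [← RelCWComplex.closure_openCell_eq_closedCell]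
    exact he
  have := RelCWComplex.closedCell_subset_skeleton (C := (univ : Set Y)) d j he'
  exact (CWComplex.disjoint_skeleton_openCell (C := (univ : Set Y)) (n := d) (m := k) (j := i)
    (by exact_mod_cast not_le.mp hk)).le_bot ⟨this, hx⟩

/-- No other closed cell meets a top-dimensional open cell: frontiers lie in skeleta of smaller
dimension, and distinct open cells are disjoint. The weak topology then makes the complement closed.
-/
theorem isOpen_of_mem_openCells [T2Space Y] {K : CWComplex (univ : Set Y)} {d : ℕ}
    (hd : ∀ k, ∀ c ∈ openCells K k, k ≤ d) {c : Set Y} (hc : c ∈ openCells K d) : IsOpen c := by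
  let _ := K
  obtain ⟨i, rfl⟩ := hc
  change IsOpen (CWComplex.openCell (C := (univ : Set Y)) d i)
  rw [← isClosed_compl_iff]
  apply CWComplex.isClosed_of_isClosed_inter_openCell_or_isClosed_inter_closedCell
    (C := (univ : Set Y)) (subset_univ _)
  intro k _ j
  by_cases h : (⟨k, j⟩ : Σ k, RelCWComplex.cell (univ : Set Y) k) = ⟨d, i⟩
  · cases h
    left
    simp
  · right
    have hsub : CWComplex.closedCell (C := (univ : Set Y)) k j ⊆
        (CWComplex.openCell (C := (univ : Set Y)) d i)ᶜ := by
      rw [← CWComplex.cellFrontier_union_openCell_eq_closedCell, union_subset_iff]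
      constructor
      · rw [subset_compl_iff_disjoint_right]
        have h1 := RelCWComplex.cellFrontier_subset_skeletonLT (C := (univ : Set Y)) k j
        refine Disjoint.mono_left h1 (CWComplex.disjoint_skeletonLT_openCell ?_)
        exact_mod_cast hd k _ ⟨j, rfl⟩
      · rw [subset_compl_iff_disjoint_right]
        exact CWComplex.disjoint_openCell_of_ne h
    rw [inter_eq_right.mpr hsub]
    exact RelCWComplex.isClosed_closedCell

end Cells

namespace SubdivisionRule

variable {S : Type u} [TopologicalSpace S] [T2Space S] {d : ℕ} (R : SubdivisionRule S d)

theorem dim_sub_le {k : ℕ} {c : Set S} (hc : c ∈ openCells R.sub k) : k ≤ d := by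
  obtain ⟨m, hm, e, he, -⟩ := R.isSubdivision k c hc
  exact hm.trans (R.pure_cw.dim_le he)

theorem le_dim_of_subset {k m : ℕ} {c e : Set S} (hc : c ∈ openCells R.sub k)
    (he : e ∈ openCells R.cw m) (h : c ⊆ e) : k ≤ m := by
  obtain ⟨m', hm, e', he', hce⟩ := R.isSubdivision k c hc
  obtain ⟨x, hx⟩ := nonempty_of_mem_openCells hc
  obtain ⟨rfl, rfl⟩ := openCells_eq_of_inter_nonempty he he' ⟨x, h hx, hce hx⟩
  exact hm

end SubdivisionRule

/-! ### Tiles of the iterated subdivisions and their parents. -/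

namespace RComplex

variable {S : Type u} [TopologicalSpace S] [T2Space S] {d : ℕ} {R : SubdivisionRule S d}
  {X : Type v} [TopologicalSpace X] [T2Space X] (A : RComplex R X)

theorem stageMap_succ (n : ℕ) : A.stageMap (n + 1) = R.φ ∘ A.stageMap n := by
  simp only [stageMap, Function.iterate_succ', Function.comp_assoc]

theorem continuous_stageMap (n : ℕ) : Continuous (A.stageMap n) :=
  (R.continuous_φ.iterate n).comp A.continuous_f

theorem image_inter_preimage_of_subset {α β : Type*} {g : α → β} {e : Set α} {c : Set β}
    (h : c ⊆ g '' e) : g '' (e ∩ g ⁻¹' c) = c := by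
  rw [image_inter_preimage, inter_eq_right.mpr h]

theorem stageMap_image_mem (n : ℕ) : ∀ {k : ℕ} {t : Set X}, t ∈ A.cells n k →
    A.stageMap n '' t ∈ openCells R.cw k := by
  induction n with
  | zero =>
    intro k t ht
    obtain ⟨c, hc, h, -⟩ := A.cellwise_f k t ht
    change A.f '' t ∈ _
    rwa [h]
  | succ n ih =>
    rintro k t ⟨m, e, he, c, hc, hce, rfl⟩
    rw [stageMap_succ, image_comp, image_inter_preimage_of_subset hce]
    obtain ⟨c', hc', h, -⟩ := R.cellwise_φ k c hc
    rwa [h]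

theorem nonempty_of_mem_cells (n : ℕ) {k : ℕ} {t : Set X} (ht : t ∈ A.cells n k) : t.Nonempty :=
  image_nonempty.mp (nonempty_of_mem_openCells (A.stageMap_image_mem n ht))

theorem dim_cells_le (n : ℕ) {k : ℕ} {t : Set X} (ht : t ∈ A.cells n k) : k ≤ d :=
  R.pure_cw.dim_le (A.stageMap_image_mem n ht)

theorem cells_eq_of_inter_nonempty (n : ℕ) : ∀ {k l : ℕ} {s t : Set X}, s ∈ A.cells n k →
    t ∈ A.cells n l → (s ∩ t).Nonempty → s = t := by
  induction n with
  | zero => exact fun hs ht h => (openCells_eq_of_inter_nonempty hs ht h).2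
  | succ n ih =>
    rintro k l _ _ ⟨m, e, he, c, hc, hce, rfl⟩ ⟨m', e', he', c', hc', hce', rfl⟩ ⟨x, hx, hx'⟩
    obtain rfl := ih he he' ⟨x, hx.1, hx'.1⟩
    rw [(openCells_eq_of_inter_nonempty hc hc' ⟨_, hx.2, hx'.2⟩).2]

/-- The cells of the later stages are given only as sets, so openness is carried along by induction:
a `d`-dimensional piece is cut out of a `d`-cell by the preimage of an open `d`-cell of `R.sub`. -/
theorem isOpen_of_mem_cells (n : ℕ) : ∀ {t : Set X}, t ∈ A.cells n d → IsOpen t := by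
  induction n with
  | zero => exact fun ht => isOpen_of_mem_openCells (fun _ _ h => A.pure_cw.dim_le h) ht
  | succ n ih =>
    rintro _ ⟨m, e, he, c, hc, hce, rfl⟩
    have hm : m = d := le_antisymm (A.dim_cells_le n he)
      (R.le_dim_of_subset hc (A.stageMap_image_mem n he) hce)
    subst hm
    exact (ih he).inter ((isOpen_of_mem_openCells (fun _ _ h => R.dim_sub_le h) hc).preimage
      (A.continuous_stageMap n))

theorem eq_of_inter_closure_nonempty (n : ℕ) {s t : Set X} (hs : s ∈ A.cells n d)
    (ht : t ∈ A.cells n d) (h : (s ∩ closure t).Nonempty) : s = t := by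
  obtain ⟨x, hx, hx'⟩ := h
  exact A.cells_eq_of_inter_nonempty n hs ht
    (mem_closure_iff.mp hx' s (A.isOpen_of_mem_cells n hs) hx)

theorem exists_parent (n : ℕ) (t : A.Tile (n + 1)) : ∃ p : A.Tile n, t.1 ⊆ p.1 := by
  obtain ⟨t, ⟨m, e, he, c, hc, hce, rfl⟩, hid⟩ := t
  have hm : m = d := le_antisymm (A.dim_cells_le n he)
    (R.le_dim_of_subset hc (A.stageMap_image_mem n he) hce)
  subst hm
  refine ⟨⟨e, he, fun h => hid ?_⟩, inter_subset_left⟩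
  rw [stageMap_succ, image_comp, image_inter_preimage_of_subset hce]
  exact R.ideal_subdivides _ h c hc hce

theorem parent_unique {n m : ℕ} {t : A.Tile m} {p p' : A.Tile n} (h : t.1 ⊆ p.1) (h' : t.1 ⊆ p'.1) :
    p = p' := by
  obtain ⟨x, hx⟩ := A.nonempty_of_mem_cells m t.2.1
  exact Subtype.ext (A.cells_eq_of_inter_nonempty n p.2.1 p'.2.1 ⟨x, h hx, h' hx⟩)

/-- A common facet lies in a single cell `e` of the coarser stage, of dimension `d - 1` or `d`. In
the second case `e` is an open tile meeting the closures of both parents, hence equals both; in the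
first it is a common facet of the parents. -/
theorem facetAdj_parents {n : ℕ} {s t p q : Set X} (hp : p ∈ A.cells n d) (hq : q ∈ A.cells n d)
    (hsp : s ⊆ p) (htq : t ⊆ q) (h : A.FacetAdj (n + 1) s t) : p = q ∨ A.FacetAdj n p q := by
  obtain ⟨-, k, hk, _, ⟨m, e, he, c, hc, hce, rfl⟩, x, hxe, hxs, hxt⟩ := h
  have hxp := closure_mono hsp hxs
  have hxq := closure_mono htq hxt
  have hkm := R.le_dim_of_subset hc (A.stageMap_image_mem n he) hce
  have hmd := A.dim_cells_le n he
  rcases hmd.eq_or_lt with rfl | hlt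
  · left
    rw [← A.eq_of_inter_closure_nonempty n he hp ⟨x, hxe.1, hxp⟩,
      A.eq_of_inter_closure_nonempty n he hq ⟨x, hxe.1, hxq⟩]
  · by_cases hpq : p = q
    · exact Or.inl hpq
    · exact Or.inr ⟨hpq, m, by omega, e, he, x, hxe.1, hxp, hxq⟩

theorem finite_tile_zero (hX : IsFiniteComplex A.cw) : Finite (A.Tile 0) := by
  have : (A.cells 0 d).Finite := hX.subset (subset_iUnion (openCells A.cw) d)
  have : Finite {t : Set X // t ∈ A.cells 0 d} := this
  exact Finite.of_injective (fun t : A.Tile 0 => (⟨t.1, t.2.1⟩ : {t : Set X // t ∈ A.cells 0 d}))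
    fun s t h => Subtype.ext (by simpa using h)

/-- The parent of a tile of the history graph; tiles of the initial complex are their own
parents. -/
noncomputable def parent : (Σ n, A.Tile n) → Σ n, A.Tile n
  | ⟨0, t⟩ => ⟨0, t⟩
  | ⟨n + 1, t⟩ => ⟨n, (A.exists_parent n t).choose⟩

end RComplex

/-! ## Coarse geometry of graphs -/

/-- The vertices `x` and `y` are joined by a path of length at most `k`. -/
def DistLE {V : Type*} (K : SimpleGraph V) (k : ℕ) (x y : V) : Prop :=
  K.edist x y ≤ k

namespace DistLE

variable {V W : Type*} {K : SimpleGraph V} {L : SimpleGraph W} {k l : ℕ} {x y z : V}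

theorem iff_walk : DistLE K k x y ↔ ∃ p : K.Walk x y, p.length ≤ k := by
  constructor
  · intro h
    obtain ⟨p, hp⟩ := SimpleGraph.exists_walk_of_edist_ne_top
      (ne_top_of_le_ne_top (ENat.natCast_ne_top k) h)
    exact ⟨p, by unfold DistLE at h; rw [← hp] at h; exact_mod_cast h⟩
  · rintro ⟨p, hp⟩
    exact (SimpleGraph.edist_le p).trans (by exact_mod_cast hp)

theorem iff_dist (hK : K.Connected) : DistLE K k x y ↔ K.dist x y ≤ k := by
  rw [DistLE, ← (hK x y).coe_dist_eq_edist, Nat.cast_le]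

theorem refl : DistLE K k x x := by
  simp [DistLE]

theorem of_eq (h : x = y) : DistLE K k x y := h ▸ refl

theorem symm (h : DistLE K k x y) : DistLE K k y x := by
  rwa [DistLE, SimpleGraph.edist_comm]

theorem trans (h : DistLE K k x y) (h' : DistLE K l y z) : DistLE K (k + l) x z :=
  SimpleGraph.edist_triangle.trans (by push_cast; exact add_le_add h h')

theorem mono (h : DistLE K k x y) (hkl : k ≤ l) : DistLE K l x y :=
  le_trans (b := (k : ℕ∞)) h (by exact_mod_cast hkl)

theorem of_adj (h : K.Adj x y) : DistLE K 1 x y :=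
  iff_walk.mpr ⟨h.toWalk, by simp⟩

/-- A map which moves the ends of every edge in an invariant set `P` of vertices by at most `c`
multiplies lengths of paths in `P` by at most `c`. -/
theorem map_of {P : V → Prop} (h : DistLE K k x y) (hx : P x) (φ : V → W) (c : ℕ)
    (hP : ∀ a b, K.Adj a b → P a → P b)
    (hφ : ∀ a b, K.Adj a b → P a → P b → DistLE L c (φ a) (φ b)) :
    DistLE L (c * k) (φ x) (φ y) := by
  obtain ⟨p, hp⟩ := iff_walk.mp h
  refine mono ?_ (Nat.mul_le_mul_left c hp)
  clear hp h
  induction p with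
  | nil => exact refl
  | cons hab p ih =>
    have := (hφ _ _ hab hx (hP _ _ hab hx)).trans (ih (hP _ _ hab hx))
    rw [SimpleGraph.Walk.length_cons]
    exact this.mono (by ring_nf; rfl)

theorem map (h : DistLE K k x y) (φ : V → W) (c : ℕ)
    (hφ : ∀ a b, K.Adj a b → DistLE L c (φ a) (φ b)) : DistLE L (c * k) (φ x) (φ y) :=
  h.map_of (P := fun _ => True) trivial φ c (by simp) (fun a b hab _ _ => hφ a b hab)

theorem mono_graph {K' : SimpleGraph V} (h : DistLE K k x y) (hK : K ≤ K') : DistLE K' k x y :=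
  (SimpleGraph.edist_anti hK).trans h

/-- Concatenation of short steps along a sequence. -/
theorem of_steps {c : ℕ} {f : ℕ → V} {m n : ℕ} (hmn : m ≤ n)
    (h : ∀ i, m ≤ i → i < n → DistLE K c (f i) (f (i + 1))) :
    DistLE K (c * (n - m)) (f m) (f n) := by
  induction n, hmn using Nat.le_induction with
  | base => exact refl
  | succ n hmn ih =>
    refine ((ih fun i hi hin => h i hi (by omega)).trans (h n hmn (by omega))).mono ?_
    rw [Nat.sub_add_comm hmn, Nat.mul_add, Nat.mul_one]

end DistLE

/-! ### Paths outside a ball. -/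

section OffBall

variable {V : Type*} {K : SimpleGraph V} {k r : ℕ} {o x y : V}

/-- The graph outside of the open ball of radius `r` about `o`. -/
def offBall (K : SimpleGraph V) (o : V) (r : ℕ) : SimpleGraph V where
  Adj x y := K.Adj x y ∧ r ≤ K.dist o x ∧ r ≤ K.dist o y
  symm := ⟨fun _ _ h => ⟨h.1.symm, h.2.2, h.2.1⟩⟩
  loopless := ⟨fun _ h => K.loopless.irrefl _ h.1⟩

theorem DistLE.offBall_of_far (hK : K.Connected) (h : DistLE K k x y) (hx : r + k ≤ K.dist o x) :
    DistLE (offBall K o r) k x y := by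
  obtain ⟨p, hp⟩ := iff_walk.mp h
  clear h
  induction p generalizing k with
  | nil => exact refl
  | cons hab p ih =>
    rw [SimpleGraph.Walk.length_cons] at hp
    obtain ⟨k, rfl⟩ : ∃ k', k = k' + 1 := ⟨k - 1, by omega⟩
    rename_i a b c
    have h1 := hK.dist_triangle (u := o) (v := b) (w := a)
    have h2 : K.dist b a = 1 := SimpleGraph.dist_eq_one_iff_adj.mpr hab.symm
    have h3 : (offBall K o r).Adj a b := ⟨hab, by omega, by omega⟩
    exact ((of_adj h3).trans (ih (k := k) (by omega) (by omega))).mono (by omega)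

theorem avoidantDist_le_of_distLE (hK : K.Connected) (hx : r ≤ K.dist o x)
    (h : DistLE (offBall K o r) k x y) : avoidantDist K o r x y ≤ k := by
  obtain ⟨p, hp⟩ := DistLE.iff_walk.mp h
  suffices ∃ q : K.Walk x y, q.length = p.length ∧ ∀ z ∈ q.support, r ≤ K.dist o z by
    obtain ⟨q, hq, hs⟩ := this
    refine (iInf₂_le q fun z hz => ?_).trans (by rw [hq]; exact_mod_cast hp)
    rw [← (hK o z).coe_dist_eq_edist]
    exact_mod_cast hs z hz
  clear hp h
  induction p with
  | nil => exact ⟨.nil, rfl, by simpa using hx⟩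
  | cons hab p ih =>
    obtain ⟨q, hq, hs⟩ := ih hab.2.2
    exact ⟨.cons hab.1 q, by simp [hq], by simpa using ⟨hx, hs⟩⟩

/-- The separate condition on `x` is there for the empty walk, which has no edge to witness that its
vertex lies outside the ball. -/
theorem avoidantDist_le_iff (hK : K.Connected) :
    avoidantDist K o r x y ≤ k ↔ r ≤ K.dist o x ∧ DistLE (offBall K o r) k x y := by
  refine ⟨fun h => ?_, fun h => avoidantDist_le_of_distLE hK h.1 h.2⟩
  have hlt : avoidantDist K o r x y < (k + 1 : ℕ) :=
    h.trans_lt (by exact_mod_cast Nat.lt_succ_self k)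
  simp only [avoidantDist, iInf_lt_iff] at hlt
  obtain ⟨p, hs, hp⟩ := hlt
  replace hs : ∀ z ∈ p.support, r ≤ K.dist o z := fun z hz => by
    have := hs z hz
    rw [← (hK o z).coe_dist_eq_edist] at this
    exact_mod_cast this
  refine ⟨hs x p.start_mem_support, ?_⟩
  rw [DistLE.iff_walk]
  suffices ∃ q : (offBall K o r).Walk x y, q.length = p.length by
    obtain ⟨q, hq⟩ := this
    exact ⟨q, by rw [hq]; exact Nat.lt_succ_iff.mp (by exact_mod_cast hp)⟩
  clear hp h
  induction p with
  | nil => exact ⟨.nil, rfl⟩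
  | cons hab p ih =>
    simp only [SimpleGraph.Walk.support_cons, List.mem_cons, forall_eq_or_imp] at hs
    obtain ⟨q, hq⟩ := ih hs.2
    have h3 : (offBall K o r).Adj _ _ := ⟨hab, hs.1, hs.2 _ p.start_mem_support⟩
    exact ⟨.cons h3 q, by rw [SimpleGraph.Walk.length_cons, SimpleGraph.Walk.length_cons, hq]⟩

end OffBall

/-! ## Levels -/

/-- A graph with levels in which every vertex of positive level has a parent, the edges either
join a vertex to its parent or are horizontal, and taking parents maps horizontal edges to
horizontal edges or vertices. -/
structure IsHistory {V : Type*} (Γ : SimpleGraph V) (lev : V → ℕ) (par : V → V) : Prop where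
  adj : ∀ {u v}, Γ.Adj u v →
    lev u = lev v ∨ (lev v = lev u + 1 ∧ par v = u) ∨ (lev u = lev v + 1 ∧ par u = v)
  lev_par : ∀ v, lev (par v) = lev v - 1
  adj_par : ∀ {v}, 0 < lev v → Γ.Adj v (par v)
  adj_par_par : ∀ {u v}, Γ.Adj u v → lev u = lev v → par u = par v ∨ Γ.Adj (par u) (par v)

/-- The graph of the horizontal edges. -/
def horizontal {V : Type*} (Γ : SimpleGraph V) (lev : V → ℕ) : SimpleGraph V where
  Adj u v := Γ.Adj u v ∧ lev u = lev v
  symm := ⟨fun _ _ h => ⟨h.1.symm, h.2.symm⟩⟩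
  loopless := ⟨fun _ h => Γ.loopless.irrefl _ h.1⟩

/-- The ancestor of `v` at level `m`. -/
def ancestor {V : Type*} (lev : V → ℕ) (par : V → V) (m : ℕ) (v : V) : V :=
  par^[lev v - m] v

namespace IsHistory

variable {V : Type*} {Γ : SimpleGraph V} {lev : V → ℕ} {par : V → V} {k m n : ℕ} {u v : V}

theorem lev_iterate_par (hΓ : IsHistory Γ lev par)
    (i : ℕ) (v : V) : lev (par^[i] v) = lev v - i := by
  induction i with
  | zero => rfl
  | succ i ih => rw [Function.iterate_succ_apply', hΓ.lev_par, ih]; omega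

theorem lev_ancestor (hΓ : IsHistory Γ lev par)
    (h : m ≤ lev v) : lev (ancestor lev par m v) = m := by
  rw [ancestor, hΓ.lev_iterate_par]; omega

theorem ancestor_of_le (h : lev v ≤ m) : ancestor lev par m v = v := by
  rw [ancestor, Nat.sub_eq_zero_of_le h]; rfl

theorem ancestor_ancestor (hΓ : IsHistory Γ lev par) (hmn : m ≤ n) :
    ancestor lev par m (ancestor lev par n v) = ancestor lev par m v := by
  rw [ancestor, ancestor, ancestor, hΓ.lev_iterate_par, ← Function.iterate_add_apply]
  congr 1
  omega

theorem ancestor_par (hΓ : IsHistory Γ lev par)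
    (h : m < lev v) : ancestor lev par m (par v) = ancestor lev par m v := by
  rw [ancestor, ancestor, hΓ.lev_par, ← Function.iterate_succ_apply]
  congr 1
  omega

theorem lev_eq_of_horizontal (h : DistLE (horizontal Γ lev) k u v) : lev u = lev v := by
  obtain ⟨p, -⟩ := DistLE.iff_walk.mp h
  clear h
  induction p with
  | nil => rfl
  | cons hab p ih => exact hab.2.trans ih

theorem horizontal_le : horizontal Γ lev ≤ Γ := fun _ _ h => h.1

theorem horizontal_iterate_par (hΓ : IsHistory Γ lev par)
    (i : ℕ) (h : DistLE (horizontal Γ lev) k u v) :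
    DistLE (horizontal Γ lev) k (par^[i] u) (par^[i] v) := by
  induction i with
  | zero => exact h
  | succ i ih =>
    rw [Function.iterate_succ_apply', Function.iterate_succ_apply']
    refine (ih.map par 1 fun a b hab => ?_).mono (by omega)
    rcases hΓ.adj_par_par hab.1 hab.2 with h | h
    · exact .of_eq h
    · exact .of_adj ⟨h, by rw [hΓ.lev_par, hΓ.lev_par, hab.2]⟩

theorem horizontal_ancestor (hΓ : IsHistory Γ lev par)
    (m : ℕ) (h : DistLE (horizontal Γ lev) k u v) :
    DistLE (horizontal Γ lev) k (ancestor lev par m u) (ancestor lev par m v) := by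
  rw [ancestor, ancestor, lev_eq_of_horizontal h]
  exact hΓ.horizontal_iterate_par _ h

theorem horizontal_ancestor_of_adj (hΓ : IsHistory Γ lev par)
    (h : Γ.Adj u v) (hu : m ≤ lev u) (hv : m ≤ lev v) :
    DistLE (horizontal Γ lev) 1 (ancestor lev par m u) (ancestor lev par m v) := by
  rcases hΓ.adj h with h' | ⟨h', rfl⟩ | ⟨h', rfl⟩
  · exact hΓ.horizontal_ancestor m (.of_adj ⟨h, h'⟩)
  · exact .of_eq (hΓ.ancestor_par (by omega))
  · exact .of_eq (hΓ.ancestor_par (by omega)).symm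

theorem lev_le_add (hΓ : IsHistory Γ lev par) (h : DistLE Γ k u v) : lev u ≤ lev v + k := by
  obtain ⟨p, hp⟩ := DistLE.iff_walk.mp h
  clear h
  induction p generalizing k with
  | nil => omega
  | cons hab p ih =>
    rw [SimpleGraph.Walk.length_cons] at hp
    have := ih (k := k - 1) (by omega)
    rcases hΓ.adj hab with h' | ⟨h', -⟩ | ⟨h', -⟩ <;> omega

theorem lev_le_add_dist (hΓ : IsHistory Γ lev par)
    (hc : Γ.Connected) (u v : V) : lev u ≤ lev v + Γ.dist u v :=
  hΓ.lev_le_add ((DistLE.iff_dist hc).mpr le_rfl)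

/-- Taking ancestors at level `m` does not increase distances, far above level `m`. -/
theorem horizontal_ancestor_of_distLE (hΓ : IsHistory Γ lev par)
    (h : DistLE Γ k u v) (hu : m + k ≤ lev u) :
    DistLE (horizontal Γ lev) k (ancestor lev par m u) (ancestor lev par m v) := by
  obtain ⟨p, hp⟩ := DistLE.iff_walk.mp h
  clear h
  induction p generalizing k with
  | nil => exact .refl
  | cons hab p ih =>
    rw [SimpleGraph.Walk.length_cons] at hp
    obtain ⟨k, rfl⟩ : ∃ k', k = k' + 1 := ⟨k - 1, by omega⟩
    have h1 := hΓ.lev_le_add (DistLE.of_adj hab)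
    exact ((hΓ.horizontal_ancestor_of_adj hab (by omega) (by omega)).trans
      (ih (k := k) (by omega) (by omega))).mono (by omega)

theorem par_ancestor (h : m < lev v) :
    par (ancestor lev par (m + 1) v) = ancestor lev par m v := by
  rw [ancestor, ancestor, ← Function.iterate_succ_apply' par]
  congr 1
  omega

/-- The graph `K` is left free so that the same climb can be made in `Γ`, beyond a level, or outside
a ball. -/
theorem distLE_ancestor (hmn : m ≤ n) (hn : n ≤ lev v) {K : SimpleGraph V}
    (hK : ∀ i, m < i → i ≤ n → K.Adj (ancestor lev par i v) (par (ancestor lev par i v))) :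
    DistLE K (n - m) (ancestor lev par n v) (ancestor lev par m v) := by
  induction n, hmn using Nat.le_induction with
  | base => exact .refl
  | succ n hmn ih =>
    have h1 : par (ancestor lev par (n + 1) v) = ancestor lev par n v := par_ancestor hn
    have h2 := (DistLE.of_adj (hK (n + 1) (by omega) le_rfl)).trans
      (h1 ▸ ih (by omega) fun i hi hin => hK i hi (by omega))
    exact h2.mono (by omega)

theorem distLE_ancestor_self (hΓ : IsHistory Γ lev par)
    (h : m ≤ lev v) : DistLE Γ (lev v - m) v (ancestor lev par m v) := by
  have := distLE_ancestor (K := Γ) h le_rfl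
    fun i hi hin => hΓ.adj_par (by rw [hΓ.lev_ancestor hin]; omega)
  rwa [ancestor_of_le le_rfl] at this

end IsHistory

/-! ### The history graph as a graph with levels and parents. -/

namespace RComplex

variable {S : Type u} [TopologicalSpace S] [T2Space S] {d : ℕ} {R : SubdivisionRule S d}
  {X : Type v} [TopologicalSpace X] [T2Space X] (A : RComplex R X)

theorem parent_eq {n : ℕ} {t : A.Tile (n + 1)} {p : A.Tile n} (h : t.1 ⊆ p.1) :
    A.parent ⟨n + 1, t⟩ = ⟨n, p⟩ := by
  rw [parent, A.parent_unique (A.exists_parent n t).choose_spec h]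

theorem isHistory : IsHistory A.historyGraph Sigma.fst A.parent where
  adj := by
    rintro ⟨n, s⟩ ⟨m, t⟩ (⟨h, -⟩ | ⟨h, h'⟩ | ⟨h, h'⟩)
    · exact Or.inl h
    · obtain rfl : m = n + 1 := h
      exact Or.inr (Or.inl ⟨rfl, A.parent_eq h'⟩)
    · obtain rfl : n = m + 1 := h
      exact Or.inr (Or.inr ⟨rfl, A.parent_eq h'⟩)
  lev_par := by
    rintro ⟨_ | n, t⟩ <;> rfl
  adj_par := by
    rintro ⟨_ | n, t⟩ h
    · exact absurd h (lt_irrefl _)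
    · exact Or.inr (Or.inr ⟨rfl, (A.exists_parent n t).choose_spec⟩)
  adj_par_par := by
    rintro ⟨n, s⟩ ⟨m, t⟩ h hl
    obtain rfl : n = m := hl
    rcases n with _ | n
    · exact Or.inr h
    · rcases h with ⟨-, h⟩ | ⟨h, -⟩ | ⟨h, -⟩
      · obtain ⟨p, hp⟩ := A.exists_parent n s
        obtain ⟨q, hq⟩ := A.exists_parent n t
        rw [A.parent_eq hp, A.parent_eq hq]
        rcases A.facetAdj_parents p.2.1 q.2.1 hp hq h with h | h
        · exact Or.inl (by rw [Subtype.ext h])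
        · exact Or.inr (Or.inl ⟨rfl, h⟩)
      · simp at h
      · simp at h

theorem distLE_horizontal_iff {n k : ℕ} {s t : A.Tile n} :
    DistLE (horizontal A.historyGraph Sigma.fst) k ⟨n, s⟩ ⟨n, t⟩ ↔
      DistLE (A.dualGraph n) k s t := by
  constructor
  · intro h
    obtain ⟨p, hp⟩ := DistLE.iff_walk.mp h
    refine DistLE.mono ?_ hp
    -- The end points are generalised, with casts along their levels, to permit induction on the
    -- walk.
    have key : ∀ {u v : Σ n, A.Tile n} (p : (horizontal A.historyGraph Sigma.fst).Walk u v)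
        (hu : u.1 = n) (hv : v.1 = n), DistLE (A.dualGraph n) p.length (hu ▸ u.2) (hv ▸ v.2) := by
      intro u v p
      induction p with
      | nil => exact fun _ _ => .refl
      | @cons a b c hab p ih =>
        intro ha hc
        have hb : b.1 = n := hab.2 ▸ ha
        refine (DistLE.trans (.of_adj ?_) (ih hb hc)).mono
          (by rw [SimpleGraph.Walk.length_cons, add_comm])
        obtain ⟨a, s⟩ := a
        obtain ⟨b, t⟩ := b
        obtain rfl : a = n := ha
        obtain rfl : b = a := hb
        rcases hab.1 with ⟨-, h⟩ | ⟨h, -⟩ | ⟨h, -⟩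
        · exact h
        · simp at h
        · simp at h
    exact key p rfl rfl
  · intro h
    refine (h.map (L := horizontal A.historyGraph Sigma.fst)
      (fun t => (⟨n, t⟩ : Σ n, A.Tile n)) 1 fun a b hab => ?_).mono (by omega)
    exact .of_adj ⟨Or.inl ⟨rfl, hab⟩, rfl⟩

end RComplex

/-! ## Quasi-isometries -/

/-- The maps `f` and `h` are mutually inverse quasi-isometries with constant `F`. -/
structure CoarseInverse {V W : Type*} (Γ : SimpleGraph V) (K : SimpleGraph W) (f : V → W)
    (h : W → V) (F : ℕ) : Prop where
  dist_f_le : ∀ x y, K.dist (f x) (f y) ≤ F * Γ.dist x y + F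
  le_dist_f : ∀ x y, Γ.dist x y ≤ F * K.dist (f x) (f y) + F
  dist_h_le : ∀ a b, Γ.dist (h a) (h b) ≤ F * K.dist a b + F
  le_dist_h : ∀ a b, K.dist a b ≤ F * Γ.dist (h a) (h b) + F
  dist_hf : ∀ x, Γ.dist (h (f x)) x ≤ F
  dist_fh : ∀ a, K.dist (f (h a)) a ≤ F

/-- Any vertex can be moved close to `o` by a quasi-isometry with constant `F`. -/
def CoarselyHomogeneous {V : Type*} (Γ : SimpleGraph V) (o : V) (F : ℕ) : Prop :=
  ∀ w, ∃ Φ Ψ : V → V, (∀ x y, Γ.dist (Φ x) (Φ y) ≤ F * Γ.dist x y + F) ∧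
    (∀ x y, Γ.dist (Ψ x) (Ψ y) ≤ F * Γ.dist x y + F) ∧ (∀ x, Γ.dist (Ψ (Φ x)) x ≤ F) ∧
    (∀ x, Γ.dist (Φ (Ψ x)) x ≤ F) ∧ Γ.dist (Φ o) w ≤ F

theorem CoarseInverse.mono {V W : Type*} {Γ : SimpleGraph V} {K : SimpleGraph W} {f : V → W}
    {h : W → V} {F F' : ℕ} (H : CoarseInverse Γ K f h F) (hF : F ≤ F') :
    CoarseInverse Γ K f h F' where
  dist_f_le x y := (H.dist_f_le x y).trans (by gcongr)
  le_dist_f x y := (H.le_dist_f x y).trans (by gcongr)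
  dist_h_le x y := (H.dist_h_le x y).trans (by gcongr)
  le_dist_h x y := (H.le_dist_h x y).trans (by gcongr)
  dist_hf x := (H.dist_hf x).trans hF
  dist_fh x := (H.dist_fh x).trans hF

theorem QuasiIsometric.connected {V : Type u} {W : Type v} {Γ : SimpleGraph V} {K : SimpleGraph W}
    [Nonempty W] (hK : K.Connected) (h : QuasiIsometric Γ K) : Γ.Connected := by
  obtain ⟨f, C, h1, h2⟩ := h
  obtain ⟨w⟩ := ‹Nonempty W›
  obtain ⟨x, -⟩ := h2 w
  have : Nonempty V := ⟨x⟩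
  refine ⟨fun x y => SimpleGraph.reachable_of_edist_ne_top (ne_top_of_le_ne_top ?_ (h1 x y).2)⟩
  rw [← (hK _ _).coe_dist_eq_edist]
  exact_mod_cast ENat.natCast_ne_top _

theorem QuasiIsometric.exists_coarseInverse {V : Type u} {W : Type v} {Γ : SimpleGraph V}
    {K : SimpleGraph W} (hΓ : Γ.Connected) (hK : K.Connected) (h : QuasiIsometric Γ K) :
    ∃ f h F, CoarseInverse Γ K f h F := by
  obtain ⟨f, C, h1, h2⟩ := h
  have e1 : ∀ x y, K.dist (f x) (f y) ≤ C * Γ.dist x y + C := fun x y => by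
    have := (h1 x y).1
    rw [← (hK _ _).coe_dist_eq_edist, ← (hΓ _ _).coe_dist_eq_edist] at this
    exact_mod_cast this
  have e2 : ∀ x y, Γ.dist x y ≤ C * K.dist (f x) (f y) + C := fun x y => by
    have := (h1 x y).2
    rw [← (hK _ _).coe_dist_eq_edist, ← (hΓ _ _).coe_dist_eq_edist] at this
    exact_mod_cast this
  choose g hg using h2
  have e3 : ∀ a, K.dist a (f (g a)) ≤ C := fun a => by
    have := hg a
    rw [← (hK _ _).coe_dist_eq_edist] at this
    exact_mod_cast this
  have e4 : ∀ a b, K.dist (f (g a)) (f (g b)) ≤ K.dist a b + 2 * C := fun a b => by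
    have h1 := hK.dist_triangle (u := f (g a)) (v := a) (w := f (g b))
    have h2 := hK.dist_triangle (u := a) (v := b) (w := f (g b))
    have h3 := e3 a
    have h4 := e3 b
    rw [SimpleGraph.dist_comm] at h3
    omega
  have e5 : ∀ a b, K.dist a b ≤ K.dist (f (g a)) (f (g b)) + 2 * C := fun a b => by
    have h1 := hK.dist_triangle (u := a) (v := f (g a)) (w := b)
    have h2 := hK.dist_triangle (u := f (g a)) (v := f (g b)) (w := b)
    have h3 := e3 a
    have h4 := e3 b
    rw [SimpleGraph.dist_comm] at h4
    omega
  -- The constant absorbs the additive errors `2 * C * C + C` in `dist_h_le` and `3 * C` in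
  -- `le_dist_h`.
  refine ⟨f, g, 2 * C * C + 3 * C, ?_, ?_, ?_, ?_, ?_, ?_⟩
  · exact fun x y => (e1 x y).trans (by gcongr <;> nlinarith)
  · exact fun x y => (e2 x y).trans (by gcongr <;> nlinarith)
  · intro a b
    have := e2 (g a) (g b)
    have := Nat.mul_le_mul_left C (e4 a b)
    nlinarith [Nat.zero_le (C * C * K.dist a b), Nat.zero_le (C * K.dist a b)]
  · intro a b
    have := e1 (g a) (g b)
    have := e5 a b
    nlinarith [Nat.zero_le (C * C * Γ.dist (g a) (g b)), Nat.zero_le (C * Γ.dist (g a) (g b))]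
  · intro x
    have h1 := e2 (g (f x)) x
    have h2 := e3 (f x)
    rw [SimpleGraph.dist_comm] at h2
    nlinarith [Nat.mul_le_mul_left C h2]
  · intro a
    have h2 := e3 a
    rw [SimpleGraph.dist_comm] at h2
    nlinarith

/-! ## Cayley graphs -/

section Cayley

variable {G : Type*} [Group G] {T : Set G}

theorem mulCayley_connected (hT : Subgroup.closure T = ⊤) :
    (SimpleGraph.mulCayley T).Connected := by
  have key : ∀ x ∈ Subgroup.closure T, ∀ g, (SimpleGraph.mulCayley T).Reachable g (g * x) := by
    intro x hx
    induction hx using Subgroup.closure_induction with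
    | mem t ht =>
      intro g
      by_cases h : g = g * t
      · rw [← h]
      · exact SimpleGraph.Adj.reachable
          ((SimpleGraph.mulCayley_adj' T _ _).mpr ⟨h, t, ht, Or.inl rfl⟩)
    | one => intro g; rw [mul_one]
    | mul x y _ _ hx hy => intro g; rw [← mul_assoc]; exact (hx g).trans (hy _)
    | inv x _ hx => intro g; simpa using (hx (g * x⁻¹)).symm
  refine ⟨fun a b => ?_⟩
  have := key (a⁻¹ * b) (hT ▸ Subgroup.mem_top _) a
  rwa [mul_inv_cancel_left] at this

theorem mulCayley_dist_mul_left (hT : (SimpleGraph.mulCayley T).Connected) (a x y : G) :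
    (SimpleGraph.mulCayley T).dist (a * x) (a * y) = (SimpleGraph.mulCayley T).dist x y := by
  have key : ∀ a x y : G, (SimpleGraph.mulCayley T).dist (a * x) (a * y) ≤
      (SimpleGraph.mulCayley T).dist x y := fun a x y => by
    rw [← DistLE.iff_dist hT, ← one_mul ((SimpleGraph.mulCayley T).dist x y)]
    exact ((DistLE.iff_dist hT).mpr le_rfl).map (a * ·) 1
      fun u v huv => .of_adj ((SimpleGraph.mulCayley_adj_mul_iff_right).mpr huv)
  refine le_antisymm (key a x y) ?_
  simpa using key a⁻¹ (a * x) (a * y)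

theorem avoidantDist_mul_left (hT : (SimpleGraph.mulCayley T).Connected) (a o x y : G) (n : ℕ) :
    avoidantDist (SimpleGraph.mulCayley T) (a * o) n (a * x) (a * y) =
      avoidantDist (SimpleGraph.mulCayley T) o n x y := by
  have key : ∀ a o x y : G, avoidantDist (SimpleGraph.mulCayley T) (a * o) n (a * x) (a * y) ≤
      avoidantDist (SimpleGraph.mulCayley T) o n x y := fun a o x y => by
    induction h : avoidantDist (SimpleGraph.mulCayley T) o n x y using ENat.recTopCoe with
    | top => exact le_top
    | coe k =>
      obtain ⟨h1, h2⟩ := (avoidantDist_le_iff hT).mp h.le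
      rw [avoidantDist_le_iff hT, mulCayley_dist_mul_left hT]
      refine ⟨h1, (h2.map (a * ·) 1 fun u v huv => .of_adj ?_).mono (by omega)⟩
      refine ⟨SimpleGraph.mulCayley_adj_mul_iff_right.mpr huv.1, ?_⟩
      rw [mulCayley_dist_mul_left hT, mulCayley_dist_mul_left hT]
      exact huv.2
  refine le_antisymm (key a o x y) ?_
  simpa using key a⁻¹ (a * o) (a * x) (a * y)

/-- Left translations are isometries of the Cayley graph; conjugating them by the quasi-isometry,
and translating by `f w * (f o)⁻¹`, moves `o` near `w`. -/
theorem CoarseInverse.coarselyHomogeneous {V : Type*} {Γ : SimpleGraph V} (hΓ : Γ.Connected)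
    (hT : (SimpleGraph.mulCayley T).Connected) {f : V → G} {h : G → V} {F : ℕ}
    (H : CoarseInverse Γ (SimpleGraph.mulCayley T) f h F) (o : V) :
    CoarselyHomogeneous Γ o (F * F + 2 * F) := by
  have e1 : ∀ (a : G) (x y : V), Γ.dist (h (a * f x)) (h (a * f y)) ≤
      (F * F + 2 * F) * Γ.dist x y + (F * F + 2 * F) := fun a x y => by
    have h1 := H.dist_h_le (a * f x) (a * f y)
    rw [mulCayley_dist_mul_left hT] at h1
    have h2 := Nat.mul_le_mul_left F (H.dist_f_le x y)
    nlinarith [Nat.zero_le (F * Γ.dist x y)]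
  have e2 : ∀ (a : G) (x : V), Γ.dist (h (a⁻¹ * f (h (a * f x)))) x ≤ F * F + 2 * F := fun a x => by
    have h1 := H.dist_h_le (a⁻¹ * f (h (a * f x))) (f x)
    have h2 := mulCayley_dist_mul_left hT a⁻¹ (f (h (a * f x))) (a * f x)
    rw [inv_mul_cancel_left] at h2
    rw [h2] at h1
    have h3 := Nat.mul_le_mul_left F (H.dist_fh (a * f x))
    have h4 := hΓ.dist_triangle (u := h (a⁻¹ * f (h (a * f x)))) (v := h (f x)) (w := x)
    have h5 := H.dist_hf x
    omega
  intro w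
  refine ⟨fun x => h (f w * (f o)⁻¹ * f x), fun x => h ((f w * (f o)⁻¹)⁻¹ * f x), e1 _, e1 _, e2 _,
    ?_, ?_⟩
  · have := e2 (f w * (f o)⁻¹)⁻¹
    rwa [inv_inv] at this
  · simp only [inv_mul_cancel_right]
    exact (H.dist_hf w).trans (by nlinarith)

end Cayley

/-! ## The divergence is bounded by the diameters of the levels -/

/-- The subgraph of the vertices of level at least `m`. -/
def aboveLevel {V : Type*} (Γ : SimpleGraph V) (lev : V → ℕ) (m : ℕ) : SimpleGraph V where
  Adj u v := Γ.Adj u v ∧ m ≤ lev u ∧ m ≤ lev v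
  symm := ⟨fun _ _ h => ⟨h.1.symm, h.2.2, h.2.1⟩⟩
  loopless := ⟨fun _ h => Γ.loopless.irrefl _ h.1⟩

namespace IsHistory

variable {V : Type*} {Γ : SimpleGraph V} {lev : V → ℕ} {par : V → V} {m n F : ℕ} {o v : V}

theorem distLE_aboveLevel_ancestor (hΓ : IsHistory Γ lev par) (hmn : m ≤ n) (h : n ≤ lev v) :
    DistLE (aboveLevel Γ lev m) (n - m) (ancestor lev par n v) (ancestor lev par m v) := by
  refine distLE_ancestor hmn h fun i hi hin => ?_
  have h1 := hΓ.lev_ancestor (hin.trans h)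
  refine ⟨hΓ.adj_par (by omega), by omega, ?_⟩
  rw [hΓ.lev_par]
  omega

/-- Climbing from `v` to level zero takes `lev v` steps. Together with `lev_le_dist` this identifies
levels with spheres about `o` up to a bounded error. -/
theorem dist_le_lev_add (hΓ : IsHistory Γ lev par) (hc : Γ.Connected)
    (hF : ∀ x y, lev x = 0 → lev y = 0 → Γ.dist x y ≤ F) (ho : lev o = 0) (v : V) :
    Γ.dist o v ≤ lev v + F := by
  have h1 := (DistLE.iff_dist hc).mp (hΓ.distLE_ancestor_self (Nat.zero_le (lev v)))
  have h2 := hF o _ ho (hΓ.lev_ancestor (Nat.zero_le (lev v)))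
  have h3 := hc.dist_triangle (u := o) (v := ancestor lev par 0 v) (w := v)
  rw [SimpleGraph.dist_comm] at h1
  omega

theorem lev_le_dist (hΓ : IsHistory Γ lev par) (hc : Γ.Connected) (ho : lev o = 0) (v : V) :
    lev v ≤ Γ.dist o v := by
  have := hΓ.lev_le_add_dist hc v o
  rwa [ho, zero_add, SimpleGraph.dist_comm] at this

variable {W : Type*} {K : SimpleGraph W} {f : V → W} {h : W → V} {N : ℕ}

/-- Vertices of level at least `N` have images at distance at least `n + 2 * F` from `f o`, so a
path of length `2 * F` starting there cannot enter the ball. -/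
theorem distLE_offBall_of_adj (hΓ : IsHistory Γ lev par) (hc : Γ.Connected) (hK : K.Connected)
    (H : CoarseInverse Γ K f h F) (hF1 : 1 ≤ F) (ho : lev o = 0)
    (hN : F * (n + 2 * F) + F ≤ N) {u v : V} (huv : Γ.Adj u v) (hu : N ≤ lev u) :
    DistLE (offBall K (f o) n) (2 * F) (f u) (f v) := by
  have h1 := H.dist_f_le u v
  rw [SimpleGraph.dist_eq_one_iff_adj.mpr huv] at h1
  have h2 := hΓ.lev_le_dist hc ho u
  have h3 := H.le_dist_f o u
  refine ((DistLE.iff_dist hK).mpr (h1.trans (by omega))).offBall_of_far hK ?_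
  exact Nat.le_of_mul_le_mul_left (by omega : F * (n + 2 * F) ≤ F * K.dist (f o) (f u)) hF1

theorem exists_distLE_level_of_ray (hΓ : IsHistory Γ lev par) (hc : Γ.Connected)
    (hK : K.Connected) (H : CoarseInverse Γ K f h F) (hF1 : 1 ≤ F)
    (hF : ∀ x y, lev x = 0 → lev y = 0 → Γ.dist x y ≤ F) (ho : lev o = 0)
    (hN : F * (n + 2 * F) + 2 * F < N) {ρ : ℕ → W} (hρ0 : ρ 0 = f o)
    (hρ : ∀ i j : ℕ, K.dist (ρ i) (ρ j) = ((i : ℤ) - j).natAbs) :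
    ∃ t p, n ≤ t ∧ lev p = N ∧ Γ.dist (h (ρ t)) p ≤ 2 * F ∧
      DistLE (offBall K (f o) n) (t - n + F + 2 * F * (2 * F)) (ρ n) (f p) := by
  have e0 : Γ.dist o (h (ρ 0)) ≤ F := by
    rw [hρ0, SimpleGraph.dist_comm]; exact H.dist_hf o
  have e1 : ∀ t : ℕ, K.dist (ρ 0) (ρ t) = t := fun t => by rw [hρ]; omega
  have hex : ∃ t, N ≤ lev (h (ρ t)) := by
    -- By this time the image is at least `N + 2 * F` away from its start; one `F` is lost in
    -- comparing the start with `o`, the other in comparing distance with level.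
    refine ⟨F * (N + 2 * F) + F, ?_⟩
    have h1 := H.le_dist_h (ρ 0) (ρ (F * (N + 2 * F) + F))
    rw [e1] at h1
    have h2 := hΓ.dist_le_lev_add hc hF ho (h (ρ (F * (N + 2 * F) + F)))
    have h3 := hc.dist_triangle (u := h (ρ 0)) (v := o) (w := h (ρ (F * (N + 2 * F) + F)))
    have h5 := SimpleGraph.dist_comm (G := Γ) (u := o) (v := h (ρ 0))
    have h4 := Nat.le_of_mul_le_mul_left (by omega :
      F * (N + 2 * F) ≤ F * Γ.dist (h (ρ 0)) (h (ρ (F * (N + 2 * F) + F)))) hF1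
    omega
  classical
  obtain ⟨t, ht, hmin⟩ : ∃ t, N ≤ lev (h (ρ t)) ∧ ∀ s < t, lev (h (ρ s)) < N :=
    ⟨Nat.find hex, Nat.find_spec hex, fun s hs => not_le.mp (Nat.find_min hex hs)⟩
  have hnt : n + F ≤ t := by
    have h1 := hΓ.lev_le_dist hc ho (h (ρ t))
    have h2 := hc.dist_triangle (u := o) (v := h (ρ 0)) (w := h (ρ t))
    have h3 := H.dist_h_le (ρ 0) (ρ t)
    rw [e1] at h3
    have h4 := Nat.le_of_mul_le_mul_left (by omega : F * (n + 2 * F) ≤ F * t) hF1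
    omega
  -- One step of the ray changes the level by at most `2 * F`, which bounds the overshoot at the
  -- first passage.
  have hup : lev (h (ρ t)) ≤ N + 2 * F := by
    have h1 := hmin (t - 1) (by omega)
    have h2 := H.dist_h_le (ρ t) (ρ (t - 1))
    rw [hρ, show ((t : ℤ) - ((t - 1 : ℕ) : ℤ)).natAbs = 1 by omega] at h2
    have h3 := hΓ.lev_le_add_dist hc (h (ρ t)) (h (ρ (t - 1)))
    omega
  have q1 : DistLE (offBall K (f o) n) (1 * (t - n)) (ρ n) (ρ t) := by
    refine DistLE.of_steps (by omega) fun i hi hit => .of_adj ⟨?_, ?_, ?_⟩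
    · rw [← SimpleGraph.dist_eq_one_iff_adj, hρ]; omega
    · rw [← hρ0, e1]; omega
    · rw [← hρ0, e1]; omega
  have q2 : DistLE (offBall K (f o) n) F (ρ t) (f (h (ρ t))) := by
    refine ((DistLE.iff_dist hK).mpr ?_).offBall_of_far hK ?_
    · rw [SimpleGraph.dist_comm]; exact H.dist_fh _
    · rw [← hρ0, e1]; omega
  have q3 := hΓ.distLE_aboveLevel_ancestor ht le_rfl
  rw [ancestor_of_le le_rfl] at q3
  have q4 := q3.map f (2 * F) fun a b hab =>
    hΓ.distLE_offBall_of_adj hc hK H hF1 ho (n := n) (by omega) hab.1 hab.2.1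
  refine ⟨t, _, by omega, hΓ.lev_ancestor ht, ?_, ((q1.trans q2).trans q4).mono ?_⟩
  · exact ((DistLE.iff_dist hc).mp (hΓ.distLE_ancestor_self ht)).trans (by omega)
  · have : 2 * F * (lev (h (ρ t)) - N) ≤ 2 * F * (2 * F) := Nat.mul_le_mul_left _ (by omega)
    omega

theorem avoidantDist_le_of_level (hΓ : IsHistory Γ lev par) (hc : Γ.Connected)
    (hK : K.Connected) (H : CoarseInverse Γ K f h F) (hF1 : 1 ≤ F)
    (hF : ∀ x y, lev x = 0 → lev y = 0 → Γ.dist x y ≤ F) (ho : lev o = 0)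
    (hN : F * (n + 2 * F) + 2 * F < N) {k : ℕ}
    (hk : ∀ x y, lev x = N → lev y = N → DistLE (horizontal Γ lev) k x y)
    {γ : ℤ → W} (hγ : IsGeodesicLine K γ) (hγ0 : γ 0 = f o) :
    avoidantDist K (γ 0) n (γ (-n)) (γ n) ≤ (3 * F * k + 12 * F * F + 3 * F : ℕ) := by
  have hd : ∀ i j : ℤ, K.dist (γ i) (γ j) = (i - j).natAbs := fun i j => by
    have := hγ i j
    rw [← (hK _ _).coe_dist_eq_edist] at this
    exact_mod_cast this
  obtain ⟨t, p, hnt, hp, hpt, q⟩ := hΓ.exists_distLE_level_of_ray hc hK H hF1 hF ho hN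
    (ρ := fun i => γ i) (by simpa using hγ0) fun i j => hd i j
  obtain ⟨t', p', hnt', hp', hpt', q'⟩ := hΓ.exists_distLE_level_of_ray hc hK H hF1 hF ho hN
    (ρ := fun i => γ (-i)) (by simpa using hγ0) fun i j => by
      rw [hd]; omega
  have hpp := hk p' p hp' hp
  have r := hpp.map_of (P := fun u => lev u = N) hp' f (2 * F) (fun a b hab ha => hab.2 ▸ ha)
    fun a b hab ha _ => hΓ.distLE_offBall_of_adj hc hK H hF1 ho (n := n) (by omega) hab.1 ha.ge
  have hpd := (DistLE.iff_dist hc).mp (hpp.mono_graph horizontal_le)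
  have htt := H.le_dist_h (γ t) (γ (-t'))
  -- The stopping times have no a priori bound. They are controlled because the stopped tiles are
  -- within `4 * F + k` of each other while `γ` is geodesic.
  have htt' : Γ.dist (h (γ t)) (h (γ (-t'))) ≤ 4 * F + k := by
    have h1 := hc.dist_triangle (u := h (γ t)) (v := p) (w := h (γ (-t')))
    have h2 := hc.dist_triangle (u := p) (v := p') (w := h (γ (-t')))
    rw [SimpleGraph.dist_comm] at hpd hpt'
    omega
  rw [hd] at htt
  have h5 := Nat.mul_le_mul_left F htt'
  refine avoidantDist_le_of_distLE hK (by rw [hd]; omega) ?_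
  rw [hγ0]
  refine ((q'.trans r).trans q.symm).mono ?_
  have h6 : t + t' ≤ F * (4 * F + k) + F := by omega
  have h7 : F * (4 * F + k) = 4 * (F * F) + F * k := by ring
  have h8 : 2 * F * (2 * F) = 4 * (F * F) := by ring
  have h9 : 2 * F * k = 2 * (F * k) := by ring
  have h10 : 3 * F * k + 12 * F * F + 3 * F = 3 * (F * k) + 12 * (F * F) + 3 * F := by ring
  omega

theorem divergence_le_of_level {G : Type*} [Group G] {T : Set G} {f : V → G} {h : G → V}
    (hΓ : IsHistory Γ lev par) (hc : Γ.Connected)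
    (hT : (SimpleGraph.mulCayley T).Connected)
    (H : CoarseInverse Γ (SimpleGraph.mulCayley T) f h F) (hF1 : 1 ≤ F)
    (hF : ∀ x y, lev x = 0 → lev y = 0 → Γ.dist x y ≤ F) (ho : lev o = 0)
    (hN : F * (n + 2 * F) + 2 * F < N) {k : ℕ}
    (hk : ∀ x y, lev x = N → lev y = N → DistLE (horizontal Γ lev) k x y) :
    divergence (SimpleGraph.mulCayley T) n ≤ (3 * F * k + 12 * F * F + 3 * F : ℕ) := by
  refine iSup₂_le fun γ hγ => ?_
  rw [← avoidantDist_mul_left hT (f o * (γ 0)⁻¹)]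
  refine hΓ.avoidantDist_le_of_level hc hT H hF1 hF ho hN hk (γ := fun i => f o * (γ 0)⁻¹ * γ i)
    (fun i j => ?_) (by simp)
  rw [← hγ i j, ← (hT _ _).coe_dist_eq_edist, ← (hT _ _).coe_dist_eq_edist,
    mulCayley_dist_mul_left hT]

end IsHistory

/-! ## Wide shadows -/

namespace IsHistory

variable {V : Type*} {Γ : SimpleGraph V} {lev : V → ℕ} {par : V → V} {m n F k r P : ℕ} {o v w : V}

theorem le_dist_of_lev_le (hΓ : IsHistory Γ lev par) (hc : Γ.Connected)
    (h : lev v + r ≤ lev w ∨ lev w + r ≤ lev v) : r ≤ Γ.dist w v := by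
  have h1 := hΓ.lev_le_add_dist hc w v
  have h2 := hΓ.lev_le_add_dist hc v w
  rw [SimpleGraph.dist_comm] at h2
  omega

theorem distLE_offBall_of_horizontal (hΓ : IsHistory Γ lev par) (hc : Γ.Connected) {x y : V}
    (hx : lev x + r ≤ lev w ∨ lev w + r ≤ lev x) (h : DistLE (horizontal Γ lev) k x y) :
    DistLE (offBall Γ w r) k x y := by
  refine (h.map_of (L := offBall Γ w r) (P := fun a => lev a = lev x) rfl id 1
    (fun a b hab ha => hab.2 ▸ ha) fun a b hab ha hb => .of_adj ⟨hab.1, ?_, ?_⟩).mono (by omega)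
  · exact hΓ.le_dist_of_lev_le hc (by dsimp only [id]; omega)
  · exact hΓ.le_dist_of_lev_le hc (by dsimp only [id]; omega)

theorem distLE_offBall_ancestor (hΓ : IsHistory Γ lev par) {z : V} (hm : m ≤ lev z)
    (h : ∀ i, m ≤ i → i ≤ lev z → r ≤ Γ.dist w (ancestor lev par i z)) :
    DistLE (offBall Γ w r) (lev z - m) z (ancestor lev par m z) := by
  have := distLE_ancestor (K := offBall Γ w r) hm le_rfl fun i hi hiz =>
    ⟨hΓ.adj_par (by rw [hΓ.lev_ancestor hiz]; omega), h i hi.le hiz, by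
      obtain ⟨i, rfl⟩ : ∃ i', i = i' + 1 := ⟨i - 1, by omega⟩
      rw [par_ancestor (par := par) (lev := lev) hiz]
      exact h i (by omega) (by omega)⟩
  rwa [ancestor_of_le le_rfl] at this

/-- The vertices all of whose ancestors stay away from `w` can be joined to the ancestors of `w` by
going up. -/
theorem distLE_offBall_above (hΓ : IsHistory Γ lev par) (hc : Γ.Connected) {z : V}
    (hr : r ≤ P) (hPw : P ≤ lev w) (hz : lev w - P ≤ lev z)
    (h : ∀ i, lev w - P ≤ i → i ≤ lev z → r ≤ Γ.dist w (ancestor lev par i z))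
    (hk : DistLE (horizontal Γ lev) k (ancestor lev par (lev w - P) z)
      (ancestor lev par (lev w - P) w)) :
    DistLE (offBall Γ w r) (lev z - (lev w - P) + k) z (ancestor lev par (lev w - P) w) := by
  refine (hΓ.distLE_offBall_ancestor hz h).trans (hΓ.distLE_offBall_of_horizontal hc ?_ hk)
  rw [hΓ.lev_ancestor hz]
  omega

theorem ancestor_ray {γ : ℕ → V} (hγ : ∀ i, lev (γ i) = i) (hpar : ∀ i, par (γ (i + 1)) = γ i)
    {s : ℕ} (hns : n ≤ s) : ancestor lev par n (γ s) = γ n := by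
  rw [ancestor, hγ]
  obtain ⟨t, rfl⟩ := Nat.exists_eq_add_of_le hns
  rw [Nat.add_sub_cancel_left]
  clear hns
  induction t with
  | zero => rfl
  | succ t ih => rw [← add_assoc, Function.iterate_succ_apply, hpar, ih]

section Shadow

variable {Φ Ψ : V → V}

theorem le_lev_of_far (hΓ : IsHistory Γ lev par) (hc : Γ.Connected)
    (hF : ∀ x y, lev x = 0 → lev y = 0 → Γ.dist x y ≤ F) (ho : lev o = 0)
    (hΦ : ∀ x y, Γ.dist (Φ x) (Φ y) ≤ F * Γ.dist x y + F) (hΦΨ : ∀ x, Γ.dist (Φ (Ψ x)) x ≤ F)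
    (hw : Γ.dist (Φ o) w ≤ F) {z : V} (hz : F * (n + 3 * F) + 3 * F + 1 ≤ Γ.dist w z) :
    n + 2 * F ≤ lev (Ψ z) := by
  by_contra hlt
  have h1 := hc.dist_triangle (u := w) (v := Φ o) (w := z)
  have h2 := hc.dist_triangle (u := Φ o) (v := Φ (Ψ z)) (w := z)
  have h3 := hΦ o (Ψ z)
  have h4 := hΦΨ z
  have h5 := hΓ.dist_le_lev_add hc hF ho (Ψ z)
  have h6 : F * Γ.dist o (Ψ z) ≤ F * (n + 3 * F) := Nat.mul_le_mul_left F (by omega)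
  rw [SimpleGraph.dist_comm] at hw
  omega

/-- Outside the ball about `w`, the map `Ψ` takes values so deep that each edge, stretched to length
at most `2 * F`, still projects to level `n`. Thus horizontal distances at level `n` bound detours
around any `w` from below. -/
theorem distLE_ancestor_pullback (hΓ : IsHistory Γ lev par) (hc : Γ.Connected)
    (hΨ : ∀ x y, Γ.dist (Ψ x) (Ψ y) ≤ F * Γ.dist x y + F)
    (hfar : ∀ z, r ≤ Γ.dist w z → n + 2 * F ≤ lev (Ψ z)) {x y : V}
    (h : DistLE (offBall Γ w r) k x y) :
    DistLE (horizontal Γ lev) (2 * F * k) (ancestor lev par n (Ψ x))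
      (ancestor lev par n (Ψ y)) := by
  refine h.map (fun z => ancestor lev par n (Ψ z)) (2 * F) fun a b hab => ?_
  refine hΓ.horizontal_ancestor_of_distLE ((DistLE.iff_dist hc).mpr ?_) (hfar a hab.2.1)
  have h1 := hΨ a b
  rw [SimpleGraph.dist_eq_one_iff_adj.mpr hab.1] at h1
  omega

/-- If going around `w` from `Φ v` to the ancestors of `w` is expensive, then all vertices in a
large horizontal ball at a level below `w` descend from the vicinity of `w`. -/
theorem exists_wide_shadow_of_far (hΓ : IsHistory Γ lev par) (hc : Γ.Connected) (hF1 : 1 ≤ F)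
    (hF : ∀ x y, lev x = 0 → lev y = 0 → Γ.dist x y ≤ F) (ho : lev o = 0)
    (hΦ : ∀ x y, Γ.dist (Φ x) (Φ y) ≤ F * Γ.dist x y + F)
    (hΨ : ∀ x y, Γ.dist (Ψ x) (Ψ y) ≤ F * Γ.dist x y + F)
    (hΨΦ : ∀ x, Γ.dist (Ψ (Φ x)) x ≤ F) (hw : Γ.dist (Φ o) w ≤ F)
    (hfar : ∀ z, r ≤ Γ.dist w z → n + 2 * F ≤ lev (Ψ z))
    {q s X ρ : ℕ} (hq : 2 * r ≤ q) (hs : F * (F + 2 * r + q) + 3 * F ≤ s)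
    (hX : F * (s + F) + 2 * F ≤ X) (hXw : X ≤ lev w) (hv : lev v = s)
    (hΛ : ¬ DistLE (horizontal Γ lev) (2 * F * (3 * X + 2 * ρ)) (ancestor lev par n (Ψ (Φ v)))
      (ancestor lev par n (Ψ (ancestor lev par (lev w - X) w)))) :
    ∃ x, lev x = lev w + q ∧ ∀ y,
      DistLE (horizontal Γ lev) ρ (ancestor lev par (lev w + q - r) x) y →
      DistLE (horizontal Γ lev) r (ancestor lev par (lev w - r) w)
        (ancestor lev par (lev w - r) y) := by
  set x := Φ v with hx
  have hrX : r ≤ X := by nlinarith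
  have hwx : Γ.dist w x ≤ X := by
    have h1 := hc.dist_triangle (u := w) (v := Φ o) (w := x)
    have h2 : Γ.dist (Φ o) x ≤ F * Γ.dist o v + F := hΦ o v
    have h3 := hΓ.dist_le_lev_add hc hF ho v
    have h4 : F * Γ.dist o v ≤ F * (s + F) := Nat.mul_le_mul_left F (by omega)
    rw [SimpleGraph.dist_comm] at hw
    omega
  have hwx' : DistLE Γ X w x := (DistLE.iff_dist hc).mpr hwx
  have hlx := hΓ.lev_le_add hwx'
  have hlx' := hΓ.lev_le_add hwx'.symm
  have hxu : DistLE (horizontal Γ lev) X (ancestor lev par (lev w - X) x)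
      (ancestor lev par (lev w - X) w) :=
    (hΓ.horizontal_ancestor_of_distLE hwx' (by omega)).symm
  -- A vertex cheaply reachable from `x` off the ball must have an ancestor near `w`; otherwise
  -- climbing from it and moving horizontally would contradict `hΛ`.
  have near : ∀ {k z}, lev w - X ≤ lev z →
      DistLE (horizontal Γ lev) k (ancestor lev par (lev w - X) z)
        (ancestor lev par (lev w - X) w) →
      DistLE (offBall Γ w r) (3 * X + 2 * ρ - (lev z - (lev w - X) + k)) x z →
      lev z - (lev w - X) + k ≤ 3 * X + 2 * ρ →
      ∃ i, lev w - X ≤ i ∧ i ≤ lev z ∧ Γ.dist w (ancestor lev par i z) < r := by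
    intro k z hz hk hxz hle
    by_contra! hcon
    refine hΛ (hΓ.distLE_ancestor_pullback hc hΨ hfar ?_)
    exact (hxz.trans (hΓ.distLE_offBall_above hc hrX hXw hz hcon hk)).mono (by omega)
  obtain ⟨i, hi, hix, hid⟩ := near (z := x) (by omega) hxu .refl (by omega)
  -- Since `v` has level `s`, its image `x` is far from `w`, while its `i`-th level ancestor is
  -- close to `w`.
  have hlong : r + q ≤ lev x - i := by
    have h1 := hΓ.lev_le_dist hc ho v
    have h2 := hc.dist_triangle (u := o) (v := Ψ (Φ o)) (w := v)
    have h3 := hc.dist_triangle (u := Ψ (Φ o)) (v := Ψ (Φ v)) (w := v)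
    have h4 := hΨΦ o
    rw [SimpleGraph.dist_comm] at h4
    have h5 := hΨΦ v
    have h6 := hΨ (Φ o) (Φ v)
    have h7 := hc.dist_triangle (u := Φ o) (v := w) (w := Φ v)
    have h8 := hc.dist_triangle (u := w) (v := ancestor lev par i x) (w := Φ v)
    have h9 : Γ.dist (ancestor lev par i x) (Φ v) ≤ lev x - i :=
      (DistLE.iff_dist hc).mp (hΓ.distLE_ancestor_self hix).symm
    have h10 : F * Γ.dist (Φ o) (Φ v) ≤ F * (F + r + (lev x - i)) :=
      Nat.mul_le_mul_left F (by omega)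
    have h11 := Nat.le_of_mul_le_mul_left
      (by omega : F * (F + 2 * r + q) ≤ F * (F + r + (lev x - i))) hF1
    omega
  have hilev : lev w ≤ i + r := by
    have := hΓ.lev_le_add_dist hc w (ancestor lev par i x)
    rw [hΓ.lev_ancestor hix] at this
    omega
  refine ⟨ancestor lev par (lev w + q) x, hΓ.lev_ancestor (by omega), fun y hy => ?_⟩
  rw [hΓ.ancestor_ancestor (by omega)] at hy
  have hly := lev_eq_of_horizontal hy
  rw [hΓ.lev_ancestor (by omega)] at hly
  -- As `q ≥ 2 * r`, level `lev w + q - r` is still at least `r` beyond that of `w`, so the climb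
  -- and the horizontal path to `y` stay off the ball.
  have p1 : DistLE (offBall Γ w r) (lev x - (lev w + q - r)) x
      (ancestor lev par (lev w + q - r) x) :=
    hΓ.distLE_offBall_ancestor (by omega) fun i' hi' hi'x =>
      hΓ.le_dist_of_lev_le hc (Or.inr (by rw [hΓ.lev_ancestor hi'x]; omega))
  have p2 : DistLE (offBall Γ w r) ρ (ancestor lev par (lev w + q - r) x) y :=
    hΓ.distLE_offBall_of_horizontal hc (Or.inr (by rw [hΓ.lev_ancestor (by omega)]; omega)) hy
  have p3 := hΓ.horizontal_ancestor (lev w - X) hy.symm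
  rw [hΓ.ancestor_ancestor (by omega)] at p3
  obtain ⟨i', hi', hiy, hid'⟩ := near (z := y) (by omega) (p3.trans hxu)
    ((p1.trans p2).mono (by omega)) (by omega)
  have hilev' : lev w ≤ i' + r := by
    have := hΓ.lev_le_add_dist hc w (ancestor lev par i' y)
    rw [hΓ.lev_ancestor hiy] at this
    omega
  have p4 := hΓ.horizontal_ancestor_of_distLE (m := lev w - r)
    ((DistLE.iff_dist hc).mpr hid'.le) (by omega)
  rwa [hΓ.ancestor_ancestor (by omega)] at p4

end Shadow

/-- Were the images of both rays cheaply joined to the ancestor of `w`, the triangle inequality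
would contradict `hαβ`; its constant is twice the cost of one detour plus an error `F` at each end.
-/
theorem exists_wide_shadow (hΓ : IsHistory Γ lev par) (hc : Γ.Connected) (hF1 : 1 ≤ F)
    (hF : ∀ x y, lev x = 0 → lev y = 0 → Γ.dist x y ≤ F) (ho : lev o = 0)
    (hom : CoarselyHomogeneous Γ o F) {α β : ℕ → V}
    (hα : ∀ i, lev (α i) = i) (hα' : ∀ i, par (α (i + 1)) = α i)
    (hβ : ∀ i, lev (β i) = i) (hβ' : ∀ i, par (β (i + 1)) = β i)
    (hr : F * (n + 3 * F) + 3 * F + 1 ≤ r)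
    {q s X ρ : ℕ} (hq : 2 * r ≤ q) (hs : F * (F + 2 * r + q) + 3 * F ≤ s)
    (hX : F * (s + F) + 2 * F ≤ X)
    (hαβ : ¬ DistLE (horizontal Γ lev) (4 * F * (3 * X + 2 * ρ) + 2 * F) (α n) (β n))
    (hXw : X ≤ lev w) :
    ∃ x, lev x = lev w + q ∧ ∀ y,
      DistLE (horizontal Γ lev) ρ (ancestor lev par (lev w + q - r) x) y →
      DistLE (horizontal Γ lev) r (ancestor lev par (lev w - r) w)
        (ancestor lev par (lev w - r) y) := by
  obtain ⟨Φ, Ψ, hΦ, hΨ, hΨΦ, hΦΨ, hw⟩ := hom w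
  have hfar : ∀ z, r ≤ Γ.dist w z → n + 2 * F ≤ lev (Ψ z) := fun z hz =>
    hΓ.le_lev_of_far hc hF ho hΦ hΦΨ hw (hr.trans hz)
  have hns : n + F ≤ s := by nlinarith
  have ray : ∀ γ : ℕ → V, (∀ i, lev (γ i) = i) → (∀ i, par (γ (i + 1)) = γ i) →
      DistLE (horizontal Γ lev) F (γ n) (ancestor lev par n (Ψ (Φ (γ s)))) := by
    intro γ hγ hγ'
    have h1 := hΨΦ (γ s)
    rw [SimpleGraph.dist_comm] at h1
    have h2 := hΓ.horizontal_ancestor_of_distLE (m := n) ((DistLE.iff_dist hc).mpr h1)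
      (by rw [hγ]; exact hns)
    rwa [ancestor_ray hγ hγ' (by omega)] at h2
  by_cases h : DistLE (horizontal Γ lev) (2 * F * (3 * X + 2 * ρ))
      (ancestor lev par n (Ψ (Φ (α s)))) (ancestor lev par n (Ψ (ancestor lev par (lev w - X) w)))
  · refine hΓ.exists_wide_shadow_of_far hc hF1 hF ho hΦ hΨ hΨΦ hw hfar hq hs hX hXw (hβ s)
      fun h' => hαβ ?_
    exact ((((ray α hα hα').trans h).trans h'.symm).trans (ray β hβ hβ').symm).mono
      (by ring_nf; rfl)
  · exact hΓ.exists_wide_shadow_of_far hc hF1 hF ho hΦ hΨ hΨΦ hw hfar hq hs hX hXw (hα s) h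

end IsHistory

/-! ## Chains of wide shadows -/

/-- A descending chain of vertices such that every vertex of the horizontal ball of radius `ρ`
about one of them has an ancestor in the horizontal ball of radius `r` about the previous one. -/
structure WideChain {V : Type*} (Γ : SimpleGraph V) (lev : V → ℕ) (par : V → V) (b : ℕ → V)
    (q r ρ : ℕ) : Prop where
  lev_succ : ∀ i, lev (b (i + 1)) = lev (b i) + q
  wide : ∀ i y, DistLE (horizontal Γ lev) ρ (b (i + 1)) y →
    DistLE (horizontal Γ lev) r (b i) (ancestor lev par (lev (b i)) y)

/-- The vertex `y` descends from the horizontal ball of radius `r` about `w`. -/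
def InShadow {V : Type*} (Γ : SimpleGraph V) (lev : V → ℕ) (par : V → V) (r : ℕ) (w y : V) :
    Prop :=
  lev w ≤ lev y ∧ DistLE (horizontal Γ lev) r w (ancestor lev par (lev w) y)

/-- The construction of a wide shadow is iterated from `α X`. Chain vertices are taken `r` levels
before the iterates, since the shadows are controlled at levels `lev w - r` and `lev w + q - r`. -/
theorem IsHistory.exists_wideChain {V : Type*} {Γ : SimpleGraph V} {lev : V → ℕ} {par : V → V}
    {n F : ℕ} {o : V}
    (hΓ : IsHistory Γ lev par) (hc : Γ.Connected) (hF1 : 1 ≤ F)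
    (hF : ∀ x y, lev x = 0 → lev y = 0 → Γ.dist x y ≤ F) (ho : lev o = 0)
    (hom : CoarselyHomogeneous Γ o F) {α β : ℕ → V}
    (hα : ∀ i, lev (α i) = i) (hα' : ∀ i, par (α (i + 1)) = α i)
    (hβ : ∀ i, lev (β i) = i) (hβ' : ∀ i, par (β (i + 1)) = β i) {r q s X ρ : ℕ}
    (hr : F * (n + 3 * F) + 3 * F + 1 ≤ r)
    (hq : 2 * r ≤ q) (hs : F * (F + 2 * r + q) + 3 * F ≤ s) (hX : F * (s + F) + 2 * F ≤ X)
    (hαβ : ¬ DistLE (horizontal Γ lev) (4 * F * (3 * X + 2 * ρ) + 2 * F) (α n) (β n)) :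
    ∃ b, WideChain Γ lev par b q r ρ := by
  have key : ∀ w, ∃ x, X ≤ lev w → lev x = lev w + q ∧ ∀ y,
      DistLE (horizontal Γ lev) ρ (ancestor lev par (lev w + q - r) x) y →
      DistLE (horizontal Γ lev) r (ancestor lev par (lev w - r) w)
        (ancestor lev par (lev w - r) y) := by
    intro w
    by_cases hw : X ≤ lev w
    · obtain ⟨x, hx⟩ :=
        hΓ.exists_wide_shadow hc hF1 hF ho hom hα hα' hβ hβ' hr hq hs hX hαβ hw
      exact ⟨x, fun _ => hx⟩
    -- A default value, never met: all iterates have level at least `X`.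
    · exact ⟨w, fun h => absurd h hw⟩
  choose next hnext using key
  have hW : ∀ i, lev (next^[i] (α X)) = X + i * q := by
    intro i
    induction i with
    | zero => simp [hα]
    | succ i ih =>
      rw [Function.iterate_succ_apply', (hnext _ (by omega)).1, ih]
      ring
  have hrX : r ≤ X := by nlinarith
  have hb : ∀ i, lev (ancestor lev par (X + i * q - r) (next^[i] (α X))) = X + i * q - r :=
    fun i => hΓ.lev_ancestor (by rw [hW]; omega)
  refine ⟨fun i => ancestor lev par (X + i * q - r) (next^[i] (α X)), fun i => ?_, fun i y hy => ?_⟩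
  · rw [hb, hb, Nat.add_mul]
    omega
  · rw [hb]
    have h1 := (hnext (next^[i] (α X)) (by rw [hW]; omega)).2 y
    rw [hW, ← Function.iterate_succ_apply' next] at h1
    refine h1 ?_
    rwa [Nat.add_mul, Nat.one_mul, ← Nat.add_assoc] at hy

namespace WideChain

variable {V : Type*} {Γ : SimpleGraph V} {lev : V → ℕ} {par : V → V} {b : ℕ → V} {q r ρ : ℕ}

theorem lev_add (hb : WideChain Γ lev par b q r ρ) (i j : ℕ) :
    lev (b (i + j)) = lev (b i) + j * q := by
  induction j with
  | zero => simp
  | succ j ih => rw [← add_assoc, hb.lev_succ, ih]; ring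

theorem inShadow_of_succ (hΓ : IsHistory Γ lev par) (hb : WideChain Γ lev par b q r ρ)
    (hrρ : r ≤ ρ) {i : ℕ} {y : V} (h : InShadow Γ lev par r (b (i + 1)) y) :
    InShadow Γ lev par r (b i) y := by
  have h1 := hb.lev_succ i
  have h2 := hb.wide i _ (h.2.mono hrρ)
  rw [hΓ.ancestor_ancestor (by omega)] at h2
  exact ⟨by have := h.1; omega, h2⟩

theorem inShadow_of_le (hΓ : IsHistory Γ lev par) (hb : WideChain Γ lev par b q r ρ)
    (hrρ : r ≤ ρ) {i j : ℕ} (hij : i ≤ j) {y : V} (h : InShadow Γ lev par r (b j) y) :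
    InShadow Γ lev par r (b i) y := by
  induction j, hij using Nat.le_induction with
  | base => exact h
  | succ j _ ih => exact ih (hb.inShadow_of_succ hΓ hrρ h)

theorem inShadow_self (w : V) : InShadow Γ lev par r w w :=
  ⟨le_rfl, .of_eq (IsHistory.ancestor_of_le le_rfl).symm⟩

theorem dist_le (hΓ : IsHistory Γ lev par) (hc : Γ.Connected)
    (hb : WideChain Γ lev par b q r ρ) (i : ℕ) : Γ.dist (b 0) (b i) ≤ i * (q + r) := by
  induction i with
  | zero => simp
  | succ i ih =>
    have h0 := hb.lev_succ i
    have h1 := hb.wide i (b (i + 1)) .refl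
    have h2 := (DistLE.iff_dist hc).mp ((h1.mono_graph IsHistory.horizontal_le).trans
      (hΓ.distLE_ancestor_self (by omega)).symm)
    have h3 := hc.dist_triangle (u := b 0) (v := b i) (w := b (i + 1))
    rw [Nat.add_mul]
    omega

/-- Entering the next shadow from outside of a shadow is expensive, unless one passes close to the
vertex of the chain. -/
theorem lt_of_crossing (hΓ : IsHistory Γ lev par) (hc : Γ.Connected)
    (hb : WideChain Γ lev par b q r ρ) (hq : 1 ≤ q) {i k : ℕ} {u v : V}
    (hu : ¬ InShadow Γ lev par r (b i) u) (hv : InShadow Γ lev par r (b (i + 1)) v)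
    (h : DistLE (offBall Γ (b i) (r + q)) k u v) : ρ < r + k := by
  have hl := hb.lev_succ i
  -- Vertices of the shadow before the level of `b (i + 1)` lie within distance less than `r + q` of
  -- `b i`.
  have hneck : ∀ y, r + q ≤ Γ.dist (b i) y → InShadow Γ lev par r (b i) y →
      lev (b (i + 1)) ≤ lev y := by
    intro y hy hs
    have h1 := (DistLE.iff_dist hc).mp ((hs.2.mono_graph IsHistory.horizontal_le).trans
      (hΓ.distLE_ancestor_self hs.1).symm)
    omega
  obtain ⟨p, hp⟩ := DistLE.iff_walk.mp h
  refine lt_of_lt_of_le ?_ (Nat.add_le_add_left hp r)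
  -- The walk is read backwards from `v`. While it remains in the shadow of `b i`, it stays beyond
  -- the level of `b (i + 1)`, where its projection moves at most one step at a time.
  suffices ρ < r + p.length ∨ (InShadow Γ lev par r (b i) u ∧ lev (b (i + 1)) ≤ lev u ∧
      DistLE (horizontal Γ lev) p.length (ancestor lev par (lev (b (i + 1))) u)
        (ancestor lev par (lev (b (i + 1))) v)) from this.resolve_right fun h => hu h.1
  clear hp h hu
  induction p with
  | nil =>
    by_cases hrρ : r ≤ ρ
    · exact Or.inr ⟨hb.inShadow_of_succ hΓ hrρ hv, hv.1, .refl⟩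
    · exact Or.inl (by omega)
  | @cons u u' v hab p ih =>
    rw [SimpleGraph.Walk.length_cons]
    rcases ih hv with h | ⟨h1, h2, h3⟩
    · exact Or.inl (by omega)
    by_cases hu : InShadow Γ lev par r (b i) u
    · have h4 := hneck u hab.2.1 hu
      exact Or.inr ⟨hu, h4, ((hΓ.horizontal_ancestor_of_adj hab.1 h4 h2).trans h3).mono
        (by omega)⟩
    · left
      have h4 : lev (b (i + 1)) ≤ lev u := by
        by_contra hlt
        rcases hΓ.adj hab.1 with h5 | ⟨h5, h6⟩ | ⟨h5, h6⟩
        · omega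
        · refine hu ⟨by omega, ?_⟩
          rw [← h6, hΓ.ancestor_par (by omega)]
          exact h1.2
        · omega
      by_contra hle
      -- If the walk were short, the projection of `u` would lie in the ball of radius `ρ` about `b
      -- (i + 1)`, and wideness would put `u` into the shadow.
      have h5 := (hv.2.trans (h3.symm.trans
        (hΓ.horizontal_ancestor_of_adj hab.1 h4 h2).symm)).mono (l := ρ) (by omega)
      have h6 := hb.wide i _ h5
      rw [hΓ.ancestor_ancestor (by omega)] at h6
      exact hu ⟨by omega, h6⟩

end WideChain

/-! ## Geodesics which follow a chain -/

theorem SimpleGraph.Connected.exists_geodesic {W : Type*} {K : SimpleGraph W} (hK : K.Connected)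
    (x y : W) : ∃ g : ℕ → W, g 0 = x ∧ g (K.dist x y) = y ∧
      ∀ s t : ℕ, s ≤ K.dist x y → t ≤ K.dist x y → K.dist (g s) (g t) = ((s : ℤ) - t).natAbs := by
  obtain ⟨p, hp⟩ := hK.exists_walk_length_eq_dist x y
  have key : ∀ s t : ℕ, s ≤ t → t ≤ K.dist x y →
      K.dist (p.getVert s) (p.getVert t) ≤ t - s := by
    intro s t hst ht
    rw [← DistLE.iff_dist hK, ← one_mul (t - s)]
    exact DistLE.of_steps hst fun i _ hi => .of_adj (p.adj_getVert_succ (by omega))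
  have h0 : p.getVert (K.dist x y) = y := by rw [← hp, p.getVert_length]
  refine ⟨p.getVert, p.getVert_zero, h0, ?_⟩
  have key' : ∀ s t : ℕ, s ≤ t → t ≤ K.dist x y →
      K.dist (p.getVert s) (p.getVert t) = t - s := by
    intro s t hst ht
    refine le_antisymm (key s t hst ht) ?_
    have h1 := key 0 s (Nat.zero_le s) (hst.trans ht)
    have h2 := key t _ ht le_rfl
    rw [p.getVert_zero] at h1
    rw [h0] at h2
    have h3 := hK.dist_triangle (u := x) (v := p.getVert s) (w := y)
    have h4 := hK.dist_triangle (u := p.getVert s) (v := p.getVert t) (w := y)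
    omega
  intro s t hs ht
  rcases le_total s t with h | h
  · rw [key' s t h ht]; omega
  · rw [SimpleGraph.dist_comm, key' t s h hs]; omega

namespace WideChain

variable {V : Type*} {Γ : SimpleGraph V} {lev : V → ℕ} {par : V → V} {b : ℕ → V} {q r ρ F : ℕ}

/-- A coarse path staying away from `b i` can be filled in by paths of length `2 * F` per jump,
still outside the ball of radius `r + q`; then `lt_of_crossing` applies. -/
theorem exists_hit (hΓ : IsHistory Γ lev par) (hc : Γ.Connected)
    (hb : WideChain Γ lev par b q r ρ) (hq1 : 1 ≤ q) {i L : ℕ} {y : ℕ → V}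
    (hy : ∀ t, t < L → Γ.dist (y t) (y (t + 1)) ≤ 2 * F) {s t : ℕ} (hst : s ≤ t) (htL : t ≤ L)
    (hs : ¬ InShadow Γ lev par r (b i) (y s)) (ht : InShadow Γ lev par r (b (i + 1)) (y t))
    (hle : r + 2 * F * (t - s) ≤ ρ) :
    ∃ u, s ≤ u ∧ u ≤ t ∧ Γ.dist (b i) (y u) < r + q + 2 * F := by
  by_contra! hcon
  have h1 : DistLE (offBall Γ (b i) (r + q)) (2 * F * (t - s)) (y s) (y t) :=
    DistLE.of_steps hst fun j hj hjt => ((DistLE.iff_dist hc).mpr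
      (hy j (by omega))).offBall_of_far hc (hcon j hj hjt.le)
  have h2 := hb.lt_of_crossing hΓ hc hq1 hs ht h1
  omega

/-- Far along the chain, a coarse path which is a quasi-geodesic crosses the region between two
consecutive shadows quickly and only once. -/
theorem exists_crossing (hΓ : IsHistory Γ lev par) (hc : Γ.Connected)
    (hb : WideChain Γ lev par b q r ρ) (hF1 : 1 ≤ F) (hqF : 2 * F < q) (hqr : r ≤ q)
    {τ σ : ℕ} (hτ : τ = 6 * F * (q + r) + 2 * F) (hσ : σ = F * (2 * (r + q + 2 * F)) + F)
    (hρ : r + 2 * F * (τ + 1) ≤ ρ) {k' L : ℕ} (hk' : 3 ≤ k') {y : ℕ → V}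
    (hL : L ≤ F * (3 * k' * (q + r)) + F)
    (hy0 : Γ.dist (y 0) (b 0) ≤ F) (hyL : Γ.dist (y L) (b (3 * k')) ≤ F)
    (hy : ∀ t, t < L → Γ.dist (y t) (y (t + 1)) ≤ 2 * F)
    (hy' : ∀ s t, s ≤ L → t ≤ L → ((s : ℤ) - t).natAbs ≤ F * Γ.dist (y s) (y t) + F) :
    ∃ i c, k' ≤ i ∧ i < 2 * k' ∧ c ≤ L ∧ Γ.dist (b i) (y c) < r + q + 2 * F ∧
      (∀ t, t + τ < c → ¬ InShadow Γ lev par r (b i) (y t)) ∧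
      ∀ t, c + τ + σ < t → t ≤ L → InShadow Γ lev par r (b (i + 1)) (y t) := by
  have hrρ : r ≤ ρ := by omega
  have hFρ : r + F ≤ ρ := by nlinarith
  have hout : ∀ i, 1 ≤ i → ¬ InShadow Γ lev par r (b i) (y 0) := by
    intro i hi hs
    have h1 := hΓ.lev_le_add_dist hc (y 0) (b 0)
    have h2 := hb.lev_add 0 i
    rw [zero_add] at h2
    have h3 := hs.1
    have h4 : 1 * q ≤ i * q := Nat.mul_le_mul_right q hi
    omega
  have hin : ∀ i, i + 3 ≤ 3 * k' → InShadow Γ lev par r (b i) (y L) := by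
    intro i hi
    by_contra hs
    have h1 : InShadow Γ lev par r (b (i + 1)) (b (3 * k')) :=
      hb.inShadow_of_le hΓ hrρ (by omega) (inShadow_self _)
    have h2 := hΓ.lev_le_add_dist hc (b (3 * k')) (y L)
    rw [SimpleGraph.dist_comm] at h2
    have h3 := hb.lev_add i (3 * k' - i)
    rw [show i + (3 * k' - i) = 3 * k' by omega] at h3
    have h4 : 3 * q ≤ (3 * k' - i) * q := Nat.mul_le_mul_right q (by omega)
    have h5 := hb.lt_of_crossing hΓ hc (by omega) hs h1
      (((DistLE.iff_dist hc).mpr hyL).offBall_of_far hc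
        (hΓ.le_dist_of_lev_le hc (Or.inr (by omega))))
    omega
  have hfirst : ∀ i, ∃ e, i + 3 ≤ 3 * k' → e ≤ L ∧ InShadow Γ lev par r (b i) (y e) ∧
      ∀ t < e, ¬ InShadow Γ lev par r (b i) (y t) := by
    intro i
    by_cases hi : i + 3 ≤ 3 * k'
    · classical
      have hex : ∃ t, InShadow Γ lev par r (b i) (y t) := ⟨L, hin i hi⟩
      exact ⟨Nat.find hex, fun _ => ⟨Nat.find_min' hex (hin i hi), Nat.find_spec hex,
        fun t ht => Nat.find_min hex ht⟩⟩
    · exact ⟨0, fun h => absurd h hi⟩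
  have hlast : ∀ i, ∃ e, 1 ≤ i → e ≤ L ∧ ¬ InShadow Γ lev par r (b i) (y e) ∧
      ∀ t, e < t → t ≤ L → InShadow Γ lev par r (b i) (y t) := by
    intro i
    by_cases hi : 1 ≤ i
    · classical
      refine ⟨Nat.findGreatest (fun t => ¬ InShadow Γ lev par r (b i) (y t)) L, fun _ =>
        ⟨Nat.findGreatest_le L, Nat.findGreatest_spec (P := fun t => ¬ InShadow Γ lev par r (b i)
          (y t)) (Nat.zero_le L) (hout i hi), fun t ht htL => ?_⟩⟩
      exact not_not.mp (Nat.findGreatest_is_greatest ht htL)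
    · exact ⟨0, fun h => absurd h hi⟩
  choose e he using hfirst
  choose l hl using hlast
  have hemono : ∀ i, i + 4 ≤ 3 * k' → e i ≤ e (i + 1) := by
    intro i hi
    by_contra hlt
    exact (he i (by omega)).2.2 _ (not_le.mp hlt)
      (hb.inShadow_of_succ hΓ hrρ (he (i + 1) (by omega)).2.1)
  have hlmono : ∀ i, 1 ≤ i → l i ≤ l (i + 1) := by
    intro i hi
    by_contra hlt
    exact (hl i hi).2.1 (hb.inShadow_of_succ hΓ hrρ
      ((hl (i + 1) (by omega)).2.2 _ (not_le.mp hlt) (hl i hi).1))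
  -- Pigeonhole: first entry times `e` and last outside times `l` are monotone in the index and at
  -- most `L`, which is linear in `k'`, so their sum cannot grow by more than `τ` at all `k'` middle
  -- indices.
  obtain ⟨i, hi1, hi2, hiτ⟩ : ∃ i, k' ≤ i ∧ i < 2 * k' ∧
      e (i + 1) + l (i + 1) ≤ e i + l i + τ := by
    by_contra! hcon
    have hind : ∀ j ≤ k', j * (τ + 1) ≤ e (k' + j) + l (k' + j) := by
      intro j hj
      induction j with
      | zero => simp
      | succ j ih =>
        have h1 := ih (by omega)
        have h2 := hcon (k' + j) (by omega) (by omega)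
        rw [Nat.add_mul, ← add_assoc]
        omega
    have h1 := hind k' le_rfl
    have h2 := (he (k' + k') (by omega)).1
    have h3 := (hl (k' + k') (by omega)).1
    have h4 : k' * (τ + 1) ≤ 2 * (F * (3 * k' * (q + r)) + F) := by omega
    rw [hτ] at h4
    nlinarith
  have hi3 := hemono i (by omega)
  have hi4 := hlmono i (by omega)
  have hei := he i (by omega)
  have hei' := he (i + 1) (by omega)
  have hli := hl i (by omega)
  have hli' := hl (i + 1) (by omega)
  have he1 : 1 ≤ e i := by
    by_contra h0
    have h1 := hei.2.1
    rw [show e i = 0 by omega] at h1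
    exact hout i (by omega) h1
  have hlL : l (i + 1) < L := by
    by_contra h0
    have h1 := hli'.2.1
    rw [show l (i + 1) = L by omega] at h1
    exact h1 (hin (i + 1) (by omega))
  obtain ⟨c, hc1, hc2, hc3⟩ := hb.exists_hit hΓ hc (by omega) hy (s := e i - 1) (t := e (i + 1))
    (by omega) (by omega) (hei.2.2 _ (by omega)) hei'.2.1
    ((Nat.add_le_add_left (Nat.mul_le_mul_left _ (by omega)) r).trans hρ)
  obtain ⟨c', hc1', hc2', hc3'⟩ := hb.exists_hit hΓ hc (by omega) hy (s := l i)
    (t := l (i + 1) + 1) (by omega) (by omega) hli.2.1 (hli'.2.2 _ (by omega) (by omega))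
    ((Nat.add_le_add_left (Nat.mul_le_mul_left _ (by omega)) r).trans hρ)
  -- The first and the last crossing both pass near `b i`, so a quasi-geodesic makes them at nearly
  -- the same time.
  have hcc : ((c : ℤ) - c').natAbs ≤ σ := by
    have h1 := hy' c c' (by omega) (by omega)
    have h2 := hc.dist_triangle (u := y c) (v := b i) (w := y c')
    rw [SimpleGraph.dist_comm] at hc3
    have h3 : F * Γ.dist (y c) (y c') ≤ F * (2 * (r + q + 2 * F)) :=
      Nat.mul_le_mul_left F (by omega)
    omega
  refine ⟨i, c, hi1, hi2, by omega, hc3, fun t ht => hei.2.2 t (by omega), fun t ht htL =>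
    hli'.2.2 t (by omega) htL⟩

/-- A wide chain forces long geodesic segments through its shadows; going around the midpoints of
these segments is expensive. -/
theorem exists_divergent_geodesic {W : Type*} {K : SimpleGraph W} {f : V → W} {h : W → V}
    (hΓ : IsHistory Γ lev par) (hc : Γ.Connected) (hK : K.Connected)
    (H : CoarseInverse Γ K f h F)
    (hb : WideChain Γ lev par b q r ρ) (hF1 : 1 ≤ F) (hqF : 2 * F < q) (hqr : r ≤ q)
    {τ σ M : ℕ} (hτ : τ = 6 * F * (q + r) + 2 * F) (hσ : σ = F * (2 * (r + q + 2 * F)) + F)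
    (hρ : r + 2 * F * (τ + 1) ≤ ρ) (hM : τ + σ < M) (k : ℕ) (hk : M ≤ k) :
    ∃ (L c : ℕ) (g : ℕ → W), k ≤ c ∧ c + k ≤ L ∧
      (∀ s t : ℕ, s ≤ L → t ≤ L → K.dist (g s) (g t) = ((s : ℤ) - t).natAbs) ∧
      ∀ δ : ℕ, avoidantDist K (g c) M (g (c - M)) (g (c + M)) ≤ δ → ρ < r + 2 * F * δ := by
  -- The crossing occurs at least `k'` indices from either end of the chain, which makes `c` at
  -- least `k` away from both ends of the geodesic.
  obtain ⟨k', hk'⟩ : ∃ k', k' = F * k + 2 * F + (r + q + 2 * F) + 3 := ⟨_, rfl⟩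
  obtain ⟨g, hg0, hgL, hg⟩ := hK.exists_geodesic (f (b 0)) (f (b (3 * k')))
  set L := K.dist (f (b 0)) (f (b (3 * k')))
  have hy : ∀ t, t < L → Γ.dist (h (g t)) (h (g (t + 1))) ≤ 2 * F := by
    intro t ht
    have h1 := H.dist_h_le (g t) (g (t + 1))
    rw [hg t (t + 1) (by omega) (by omega),
      show ((t : ℤ) - ((t + 1 : ℕ) : ℤ)).natAbs = 1 by omega] at h1
    omega
  have hy' : ∀ s t, s ≤ L → t ≤ L →
      ((s : ℤ) - t).natAbs ≤ F * Γ.dist (h (g s)) (h (g t)) + F := by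
    intro s t hs ht
    rw [← hg s t hs ht]
    exact H.le_dist_h _ _
  have hy0 : Γ.dist (h (g 0)) (b 0) ≤ F := by rw [hg0]; exact H.dist_hf _
  have hyL : Γ.dist (h (g L)) (b (3 * k')) ≤ F := by rw [hgL]; exact H.dist_hf _
  obtain ⟨i, c, hi1, hi2, hcL, hic, hbefore, hafter⟩ := hb.exists_crossing hΓ hc hF1 hqF hqr hτ hσ
    hρ (by omega : 3 ≤ k') (y := fun t => h (g t)) (L := L)
    ((H.dist_f_le _ _).trans (by gcongr; exact hb.dist_le hΓ hc _)) hy0 hyL hy hy'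
  have h6 : ∀ j, j * 1 ≤ j * q := fun j => Nat.mul_le_mul_left j (by omega)
  have hkc : k ≤ c := by
    have h1 := H.dist_h_le (g c) (g 0)
    rw [hg c 0 hcL (Nat.zero_le _), show ((c : ℤ) - (0 : ℕ)).natAbs = c by omega] at h1
    have h2 := hb.lev_add 0 i
    rw [zero_add] at h2
    have h3 := hΓ.lev_le_add_dist hc (b i) (b 0)
    have h4 := hc.dist_triangle (u := b i) (v := h (g c)) (w := b 0)
    have h5 := hc.dist_triangle (u := h (g c)) (v := h (g 0)) (w := b 0)
    have h7 := h6 i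
    exact Nat.le_of_mul_le_mul_left (by omega : F * k ≤ F * c) (by omega)
  have hcL' : c + k ≤ L := by
    have h1 := H.dist_h_le (g L) (g c)
    rw [hg L c le_rfl hcL, show ((L : ℤ) - c).natAbs = L - c by omega] at h1
    have h2 := hb.lev_add i (3 * k' - i)
    rw [show i + (3 * k' - i) = 3 * k' by omega] at h2
    have h3 := hΓ.lev_le_add_dist hc (b (3 * k')) (b i)
    have h4 := hc.dist_triangle (u := b (3 * k')) (v := h (g c)) (w := b i)
    have h5 := hc.dist_triangle (u := b (3 * k')) (v := h (g L)) (w := h (g c))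
    rw [SimpleGraph.dist_comm] at hyL hic
    have h7 := h6 (3 * k' - i)
    have := Nat.le_of_mul_le_mul_left (by omega : F * k ≤ F * (L - c)) (by omega)
    omega
  refine ⟨L, c, g, hkc, hcL', hg, fun δ hδ => ?_⟩
  -- Since `M > σ`, the complement of the `M`-ball about `g c` is mapped outside the neighbourhood
  -- of `b i`, with a margin `2 * F` for filling in edges.
  have hfar : ∀ a, M ≤ K.dist (g c) a → r + q + 2 * F ≤ Γ.dist (b i) (h a) := by
    intro a ha
    by_contra hlt
    have h1 := H.le_dist_h (g c) a
    have h2 := hc.dist_triangle (u := h (g c)) (v := b i) (w := h a)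
    rw [SimpleGraph.dist_comm] at hic
    have h3 : F * Γ.dist (h (g c)) (h a) ≤ F * (2 * (r + q + 2 * F)) :=
      Nat.mul_le_mul_left F (by omega)
    omega
  refine hb.lt_of_crossing hΓ hc (by omega) (hbefore (c - M) (by omega))
    (hafter (c + M) (by omega) (by omega))
    (((avoidantDist_le_iff hK).mp hδ).2.map h (2 * F) fun u v huv => ?_)
  refine DistLE.offBall_of_far hc ((DistLE.iff_dist hc).mpr ?_) (hfar u huv.2.1)
  have h1 := H.dist_h_le u v
  rw [SimpleGraph.dist_eq_one_iff_adj.mpr huv.1] at h1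
  omega

end WideChain

/-! ### Limits of geodesic segments in a Cayley graph. -/

section Limit

variable {G : Type*} [Group G] {T : Set G}

theorem mulCayley_finite_ball (hT : (SimpleGraph.mulCayley T).Connected) (hfin : T.Finite) (n : ℕ) :
    {x : G | (SimpleGraph.mulCayley T).dist 1 x ≤ n}.Finite := by
  induction n with
  | zero =>
    refine (Set.finite_singleton (1 : G)).subset fun x hx => ?_
    exact ((hT.dist_eq_zero_iff).mp (Nat.le_zero.mp hx)).symm
  | succ n ih =>
    refine (ih.union ((ih.image2 (· * ·) hfin).union
      (ih.image2 (fun y t => y * t⁻¹) hfin))).subset fun x hx => ?_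
    rcases Nat.lt_or_ge n ((SimpleGraph.mulCayley T).dist 1 x) with h | h
    · have hx' : (SimpleGraph.mulCayley T).dist 1 x = n + 1 := le_antisymm hx h
      obtain ⟨p, hp⟩ := hT.exists_walk_length_eq_dist x 1
      rw [SimpleGraph.dist_comm, hx'] at hp
      cases p with
      | nil => simp at hp
      | @cons _ y _ hxy p =>
        rw [SimpleGraph.Walk.length_cons, Nat.add_right_cancel_iff] at hp
        have hy : (SimpleGraph.mulCayley T).dist 1 y ≤ n := by
          rw [SimpleGraph.dist_comm, ← hp]
          exact SimpleGraph.dist_le p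
        obtain ⟨-, t, ht, h | h⟩ := (SimpleGraph.mulCayley_adj' T _ _).mp hxy
        · exact Or.inr (Or.inr ⟨y, hy, t, ht, by simp [← h]⟩)
        · exact Or.inr (Or.inl ⟨y, hy, t, ht, h.symm⟩)
    · exact Or.inl h

/-- Translates of longer and longer geodesic segments, centred at the identity, accumulate at a
geodesic line. -/
theorem exists_geodesicLine_of_segments (hT : (SimpleGraph.mulCayley T).Connected)
    (hfin : T.Finite) {M : ℕ} {Q : G → G → Prop}
    (hseg : ∀ k, M ≤ k → ∃ (L c : ℕ) (g : ℕ → G), k ≤ c ∧ c + k ≤ L ∧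
      (∀ s t : ℕ, s ≤ L → t ≤ L →
        (SimpleGraph.mulCayley T).dist (g s) (g t) = ((s : ℤ) - t).natAbs) ∧
      Q ((g c)⁻¹ * g (c - M)) ((g c)⁻¹ * g (c + M))) :
    ∃ γ : ℤ → G, IsGeodesicLine (SimpleGraph.mulCayley T) γ ∧ γ 0 = 1 ∧ Q (γ (-M)) (γ M) := by
  -- The shift by `M` makes the truncated subtraction `c k - M` exact.
  choose L c g hkc hcL hg hQ using fun k => hseg (M + k) (Nat.le_add_right M k)
  let η : ℕ → ℤ → G := fun k i => (g k (c k))⁻¹ * g k (c k + i).toNat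
  have hη : ∀ k (i j : ℤ), i.natAbs ≤ k → j.natAbs ≤ k →
      (SimpleGraph.mulCayley T).dist (η k i) (η k j) = (i - j).natAbs := by
    intro k i j hi hj
    have h1 := hkc k
    have h2 := hcL k
    rw [mulCayley_dist_mul_left hT, hg k _ _ (by omega) (by omega)]
    omega
  have h0 : ∀ k, η k 0 = 1 := fun k => by simp [η]
  have hev : ∀ i : ℤ, ∀ᶠ k in (Filter.hyperfilter ℕ : Filter ℕ), i.natAbs ≤ k := fun i =>
    (Filter.eventually_ge_atTop i.natAbs).filter_mono Nat.hyperfilter_le_atTop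
  -- Balls are finite, so the ultrafilter selects one value at each position; this replaces a
  -- diagonal argument.
  have hlim : ∀ i : ℤ, ∃ x : G, ∀ᶠ k in (Filter.hyperfilter ℕ : Filter ℕ), η k i = x := by
    intro i
    obtain ⟨x, -, hx⟩ := (Ultrafilter.eventually_exists_mem_iff (f := Filter.hyperfilter ℕ)
      (P := fun x k => η k i = x) (mulCayley_finite_ball hT hfin i.natAbs)).mp
      ((hev i).mono fun k hk => ⟨η k i, by
        have := hη k 0 i (Nat.zero_le _) hk
        rw [h0] at this
        simp [this], rfl⟩)
    exact ⟨x, hx⟩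
  choose γ hγ using hlim
  refine ⟨γ, fun i j => ?_, ?_, ?_⟩
  · obtain ⟨k, ⟨⟨hi, hj⟩, hi'⟩, hj'⟩ := (((hγ i).and (hγ j)).and (hev i)).and (hev j) |>.exists
    rw [← (hT _ _).coe_dist_eq_edist, ← hi, ← hj, hη k i j hi' hj']
  · obtain ⟨k, hk⟩ := (hγ 0).exists
    rw [← hk, h0]
  · obtain ⟨k, hi, hj⟩ := ((hγ (-M)).and (hγ M)).exists
    have h1 := hkc k
    have h2 := hQ k
    rw [← hi, ← hj]
    simp only [η]
    rwa [show ((c k : ℤ) + -(M : ℤ)).toNat = c k - M by omega,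
      show ((c k : ℤ) + (M : ℤ)).toNat = c k + M by omega]

end Limit

theorem CoarselyHomogeneous.mono {V : Type*} {Γ : SimpleGraph V} {o : V} {F F' : ℕ}
    (h : CoarselyHomogeneous Γ o F) (hF : F ≤ F') : CoarselyHomogeneous Γ o F' := by
  intro w
  obtain ⟨Φ, Ψ, h1, h2, h3, h4, h5⟩ := h w
  exact ⟨Φ, Ψ, fun x y => (h1 x y).trans (by gcongr), fun x y => (h2 x y).trans (by gcongr),
    fun x => (h3 x).trans hF, fun x => (h4 x).trans hF, h5.trans hF⟩

/-- In a group with a wide chain, divergence is bounded below by the width. -/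
theorem WideChain.lt_of_divergence_le {V G : Type*} [Group G] {T : Set G} {Γ : SimpleGraph V}
    {lev : V → ℕ} {par : V → V} {b : ℕ → V} {q r ρ F : ℕ} {f : V → G} {h : G → V}
    (hΓ : IsHistory Γ lev par) (hc : Γ.Connected) (hT : (SimpleGraph.mulCayley T).Connected)
    (hfin : T.Finite) (H : CoarseInverse Γ (SimpleGraph.mulCayley T) f h F)
    (hb : WideChain Γ lev par b q r ρ) (hF1 : 1 ≤ F) (hqF : 2 * F < q) (hqr : r ≤ q)
    {τ σ M : ℕ} (hτ : τ = 6 * F * (q + r) + 2 * F) (hσ : σ = F * (2 * (r + q + 2 * F)) + F)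
    (hρ : r + 2 * F * (τ + 1) ≤ ρ) (hM : τ + σ < M) {δ : ℕ}
    (hδ : divergence (SimpleGraph.mulCayley T) M ≤ δ) : ρ < r + 2 * F * δ := by
  obtain ⟨γ, hγ, h0, hQ⟩ := exists_geodesicLine_of_segments hT hfin (M := M)
    (Q := fun x y => ∀ δ : ℕ, avoidantDist (SimpleGraph.mulCayley T) 1 M x y ≤ δ →
      ρ < r + 2 * F * δ) fun k hk => by
    obtain ⟨L, c, g, h1, h2, h3, h4⟩ :=
      hb.exists_divergent_geodesic hΓ hc hT H hF1 hqF hqr hτ hσ hρ hM k hk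
    refine ⟨L, c, g, h1, h2, h3, fun δ hδ => h4 δ ?_⟩
    rwa [← avoidantDist_mul_left hT (g c)⁻¹, inv_mul_cancel]
  refine hQ δ (le_trans ?_ hδ)
  rw [← h0]
  exact le_iSup₂ (f := fun (γ : ℤ → G) (_ : IsGeodesicLine (SimpleGraph.mulCayley T) γ) =>
    avoidantDist (SimpleGraph.mulCayley T) (γ 0) M (γ (-M)) (γ M)) γ hγ

/-- The sequence `u` is bounded by an affine function. -/
def AffinelyBounded (u : ℕ → ℕ) : Prop := ∃ a b : ℕ, ∀ n, u n ≤ a * n + b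

namespace AffinelyBounded

variable {u w : ℕ → ℕ}

theorem const (c : ℕ) : AffinelyBounded fun _ => c := ⟨0, c, fun n => by simp⟩

theorem id : AffinelyBounded fun n => n := ⟨1, 0, fun n => by simp⟩

theorem add (hu : AffinelyBounded u) (hw : AffinelyBounded w) :
    AffinelyBounded fun n => u n + w n := by
  obtain ⟨a, b, h⟩ := hu
  obtain ⟨a', b', h'⟩ := hw
  refine ⟨a + a', b + b', fun n => ?_⟩
  have h1 := h n
  have h2 := h' n
  rw [add_mul]
  dsimp only
  omega

theorem const_mul (hu : AffinelyBounded u) (c : ℕ) : AffinelyBounded fun n => c * u n := by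
  obtain ⟨a, b, h⟩ := hu
  refine ⟨c * a, c * b, fun n => (Nat.mul_le_mul_left c (h n)).trans (le_of_eq ?_)⟩
  ring

end AffinelyBounded

/-- Asking for the estimate at every `N ≥ u n` allows one slope to serve also as the multiplier,
without monotonicity of `g`. -/
theorem Dominated.of_affinelyBounded {f g : ℕ → ℕ∞} {u w : ℕ → ℕ} (c : ℕ)
    (hu : AffinelyBounded u) (hw : AffinelyBounded w)
    (h : ∀ n N, u n ≤ N → f n ≤ c * g N + w n) : Dominated f g := by
  obtain ⟨a, b, hu⟩ := hu
  obtain ⟨a', b', hw⟩ := hw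
  refine ⟨c + a + a', b + b', fun n =>
    (h n ((c + a + a') * n + (b + b')) ((hu n).trans ?_)).trans ?_⟩
  · rw [add_mul, add_mul]
    omega
  · refine add_le_add (mul_le_mul_left (by exact_mod_cast (by omega : c ≤ c + a + a')) _) ?_
    have h1 := hw n
    exact_mod_cast (by rw [add_mul, add_mul]; omega : w n ≤ (c + a + a') * n + (b + b'))

theorem SimpleGraph.exists_distLE_of_ediam_ne_top {V : Type*} {K : SimpleGraph V}
    (h : K.ediam ≠ ⊤) : ∃ k : ℕ, K.ediam = k ∧ ∀ x y, DistLE K k x y := by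
  lift K.ediam to ℕ using h with k hk
  exact ⟨k, rfl, fun x y => SimpleGraph.edist_le_ediam.trans hk.ge⟩

theorem IsHistory.par_of_isGeodesicRay {V : Type*} {Γ : SimpleGraph V} {lev : V → ℕ} {par : V → V}
    (hΓ : IsHistory Γ lev par) {α : ℕ → V} (hα : IsGeodesicRay Γ α) (hlev : ∀ i, lev (α i) = i)
    (i : ℕ) : par (α (i + 1)) = α i := by
  have h1 := hα i (i + 1)
  rw [show ((i : ℤ) - ((i + 1 : ℕ) : ℤ)).natAbs = 1 by omega, Nat.cast_one,
    SimpleGraph.edist_eq_one_iff_adj] at h1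
  rcases hΓ.adj h1 with h | ⟨-, h⟩ | ⟨h, -⟩
  · rw [hlev, hlev] at h
    omega
  · exact h
  · rw [hlev, hlev] at h
    omega

/-! ### Choice of constants and conclusion. -/

theorem mainTheorem7 {S : Type*} [TopologicalSpace S] [T2Space S] {d : ℕ}
    (R : SubdivisionRule S d)
    {X : Type*} [TopologicalSpace X] [T2Space X] (A : RComplex R X) (hX : IsFiniteComplex A.cw)
    {G : Type*} [Group G] (T : Finset G) (hT : Subgroup.closure (T : Set G) = ⊤)
    (hG : QuasiIsometric A.historyGraph (SimpleGraph.mulCayley (T : Set G))) :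
    Dominated (divergence (SimpleGraph.mulCayley (T : Set G))) A.diam ∧
      ((∃ α β : (n : ℕ) → A.Tile n,
          IsGeodesicRay A.historyGraph (fun n => ⟨n, α n⟩) ∧
          IsGeodesicRay A.historyGraph (fun n => ⟨n, β n⟩) ∧
          ∀ n, (A.dualGraph n).edist (α n) (β n) = A.diam n) →
        Dominated A.diam (divergence (SimpleGraph.mulCayley (T : Set G)))) := by
  have hK := mulCayley_connected hT
  have hc := hG.connected hK
  have hΓ := A.isHistory
  obtain ⟨f, h, F₀, H₀⟩ := hG.exists_coarseInverse hc hK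
  obtain ⟨v⟩ := hc.nonempty
  obtain ⟨o, ho⟩ : ∃ o : Σ n, A.Tile n, o.1 = 0 := ⟨_, hΓ.lev_ancestor (Nat.zero_le v.1)⟩
  have := A.finite_tile_zero hX
  obtain ⟨D, hD⟩ := Finite.exists_le fun x : A.Tile 0 × A.Tile 0 =>
    A.historyGraph.dist ⟨0, x.1⟩ ⟨0, x.2⟩
  -- One constant for everything: `F₀ * F₀ + 2 * F₀` from homogeneity, `D` for the spread of level
  -- zero, and `1` for positivity.
  obtain ⟨F, hF⟩ : ∃ F, F = F₀ * F₀ + 2 * F₀ + D + 1 := ⟨_, rfl⟩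
  have hF1 : 1 ≤ F := by omega
  have H := H₀.mono (show F₀ ≤ F by rw [hF]; nlinarith [Nat.zero_le (F₀ * F₀)])
  have hom := (H₀.coarselyHomogeneous hc hK o).mono (show _ ≤ F by omega)
  have hzero : ∀ x y : Σ n, A.Tile n, x.1 = 0 → y.1 = 0 → A.historyGraph.dist x y ≤ F := by
    rintro ⟨_, x⟩ ⟨_, y⟩ rfl rfl
    exact (hD (x, y)).trans (by omega)
  constructor
  · refine .of_affinelyBounded (3 * F) (u := fun n => F * (n + 2 * F) + 2 * F + 1)
      ((((AffinelyBounded.id.add (.const _)).const_mul _).add (.const _)).add (.const _))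
      (.const (12 * F * F + 3 * F)) fun n N hN => ?_
    by_cases htop : A.diam N = ⊤
    · rw [htop, ENat.mul_top (by exact_mod_cast (by omega : 3 * F ≠ 0)), top_add]
      exact le_top
    · obtain ⟨k, hk, hdist⟩ := SimpleGraph.exists_distLE_of_ediam_ne_top htop
      refine (hΓ.divergence_le_of_level hc hK H hF1 hzero ho hN (k := k) ?_).trans ?_
      · rintro ⟨_, x⟩ ⟨_, y⟩ rfl rfl
        exact A.distLE_horizontal_iff.mpr (hdist x y)
      · rw [RComplex.diam, hk]
        exact_mod_cast (add_assoc _ _ _).le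
  · rintro ⟨α, β, hα, hβ, hαβ⟩
    let r : ℕ → ℕ := fun n => F * (n + 3 * F) + 3 * F + 1
    let q : ℕ → ℕ := fun n => 2 * r n + 2 * F
    let s : ℕ → ℕ := fun n => F * (F + 2 * r n + q n) + 3 * F
    let Y : ℕ → ℕ := fun n => F * (s n + F) + 2 * F
    let τ : ℕ → ℕ := fun n => 6 * F * (q n + r n) + 2 * F
    let σ : ℕ → ℕ := fun n => F * (2 * (r n + q n + 2 * F)) + F
    let ρ : ℕ → ℕ := fun n => r n + 2 * F * (τ n + 1)
    have hr : AffinelyBounded r :=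
      (((AffinelyBounded.id.add (.const _)).const_mul _).add (.const _)).add (.const _)
    have hq : AffinelyBounded q := (hr.const_mul _).add (.const _)
    have hs : AffinelyBounded s :=
      ((((AffinelyBounded.const _).add (hr.const_mul _)).add hq).const_mul _).add (.const _)
    have hY : AffinelyBounded Y := ((hs.add (.const _)).const_mul _).add (.const _)
    have hτ : AffinelyBounded τ := ((hq.add hr).const_mul _).add (.const _)
    have hσ : AffinelyBounded σ :=
      ((((hr.add hq).add (.const _)).const_mul _).const_mul _).add (.const _)
    have hρ : AffinelyBounded ρ := hr.add ((hτ.add (.const _)).const_mul _)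
    -- The factor is that of `δ` in `hdist` below, `4 * F * 2 * (2 * F)`.
    refine .of_affinelyBounded (16 * F * F) (u := fun n => τ n + σ n + 1)
      (w := fun n => 4 * F * (3 * Y n + 2 * ρ n) + 2 * F) ((hτ.add hσ).add (.const _))
      ((((hY.const_mul _).add (hρ.const_mul _)).const_mul _).add (.const _)) fun n M hM => ?_
    by_cases htop : divergence (SimpleGraph.mulCayley (T : Set G)) M = ⊤
    · rw [htop, ENat.mul_top (by exact_mod_cast (by nlinarith : 16 * F * F ≠ 0)), top_add]
      exact le_top
    obtain ⟨δ, hδ⟩ := ENat.ne_top_iff_exists.mp htop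
    -- The width is taken to be `ρ n + 2 * F * δ`, just too large for `lt_of_divergence_le`, which
    -- would give `ρ n < r n`.
    have hdist : DistLE (horizontal A.historyGraph Sigma.fst)
        (4 * F * (3 * Y n + 2 * (ρ n + 2 * F * δ)) + 2 * F) ⟨n, α n⟩ ⟨n, β n⟩ := by
      by_contra hfar
      obtain ⟨b, hb⟩ := hΓ.exists_wideChain hc hF1 hzero ho hom (fun _ => rfl)
        (hΓ.par_of_isGeodesicRay hα fun _ => rfl) (fun _ => rfl)
        (hΓ.par_of_isGeodesicRay hβ fun _ => rfl) (r := r n) (q := q n) (s := s n) (X := Y n)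
        le_rfl (Nat.le_add_right _ _) le_rfl le_rfl hfar
      have h1 : 1 ≤ r n := Nat.le_add_left _ _
      have h2 : q n = 2 * r n + 2 * F := rfl
      have h3 : ρ n = r n + 2 * F * (τ n + 1) := rfl
      have h4 := hb.lt_of_divergence_le hΓ hc hK T.finite_toSet H hF1 (by omega) (by omega) rfl rfl
        (h3.ge.trans (Nat.le_add_right _ _)) hM hδ.ge
      omega
    have h1 := A.distLE_horizontal_iff.mp hdist
    rw [← hαβ, ← hδ]
    refine le_trans (b := ((_ : ℕ) : ℕ∞)) h1 ?_
    exact_mod_cast (by ring_nf; rfl : _ ≤ _)
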